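/- Let $p$ be a prime and assume the $p$-adic Schanuel conjecture for $p$: whenever $m\ge 1$ and $t_1,\dots,t_m\in\mathbb C_p$ satisfy $v(t_i)>1/(p-1)$ and are linearly independent over $\mathbb Q$, the field $\mathbb Q(t_1,\dots,t_m,e^{t_1},\dots,e^{t_m})$ has transcendence degree at least $m$ over $\mathbb Q$. Put $E_p(y)=\exp(py)$ if $p\neq 2$ and $E_2(y)=\exp(4y)$. Let $\beta\in\mathbb C_p$ be algebraic over $\mathbb Q$ with $v(\beta)\ge 0$, let $d=[\mathbb Q_p(\beta):\mathbb Q_p]$, and let $c_{i,j}:\mathbb Z_p\to\mathbb Z_p$ ($0\le i\le d-1$, $1\le j\le d-1$) be the decomposition (trigonometric) functions of $E_p$ in $\mathbb Q_p(\beta)$, defined by $$E_p(x\beta^j)=c_{0,j}(x)+c_{1,j}(x)\beta+\cdots+c_{d-1,j}(x)\beta^{d-1}\qquad(x\in\mathbb Z_p).$$ Let $n\ge 1$, $L=d^2-d$ and $T=(L-d+2)n$. Let $\overline X,\overline Y_0,\dots,\overline Y_L$ be blocks of $n$ indeterminates each. For $Q\in\mathbb Z[\overline X,\overline Y_0,\dots,\overline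 Y_L]$ let $F_Q$ be the function on $\mathbb Z_p^n$ obtained from $Q$ by substituting $x_k$ for $X_k$, $E_p(x_k)$ for $Y_{0,k}$, and the $L$ functions $c_{i,j}(x_k)$ for the $Y_{1,k},\dots,Y_{L,k}$. Let $P\in\mathbb Z[\overline X,\overline Y_0,\dots,\overline Y_L]$. Assume that $F_P$ has a zero in $\mathbb Z_p^n$ and that, for every zero of $F_P$ in $\mathbb Z_p^n$, its $n$ components are linearly independent over $\mathbb Q$. Then there exist $a\in\mathbb Z_p^n$ and $R,R_1,\dots,R_T,S_1,\dots,S_T\in\mathbb Z[\overline X,\overline Y_0,\dots,\overline Y_L]$ such that 1. $F_P(a)=0$; 2. $a$ is a non-singular zero of some $n$-element subsystem $(F_{R_{s_1}},\dots,F_{R_{s_n}})$ of $(F_{R_1},\dots,F_{R_T})$, with $s_1,\dots,s_n$ distinct, i.e. $F_{R_{s_k}}(a)=0$ for all $k$ and $\det\big(\partial F_{R_{s_k}}/\partial x_l(a)\big)_{k,l}\ne 0$; 3. $F_R(a)\neq 0$; 4. $RP=\sum_{i=1}^{T}R_iS_i$. -/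

import Mathlib

noncomputable section

namespace PadicExp

/-- The `p`-adic Schanuel conjecture (for a fixed prime `p`): if `t₁, …, tₙ ∈ ℂ_p` lie in the domain
of convergence `v(t) > 1/(p-1)` of the exponential series and are linearly independent over `ℚ`, then
`ℚ(t₁, …, tₙ, exp t₁, …, exp tₙ)` has transcendence degree at least `n` over `ℚ`. -/
def SchanuelConjecture (p : ℕ) [Fact p.Prime] : Prop :=
  ∀ (n : ℕ) (t : Fin n → ℂ_[p]), 1 ≤ n →
    (∀ i, ‖t i‖ < (p : ℝ) ^ (-(1 / ((p : ℝ) - 1)))) →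
    LinearIndependent ℚ t →
    (n : Cardinal) ≤ Algebra.trdeg ℚ
      (IntermediateField.adjoin ℚ
        (Set.range t ∪ Set.range fun i => NormedSpace.exp (t i)) :
          IntermediateField ℚ ℂ_[p])

/-- The multiplier in the exponent of `E_p`: it is `p` for odd `p`, and `4` for `p = 2`. -/
def expMul (p : ℕ) : ℕ := if p = 2 then 4 else p

/-- `E_p(y) = exp(p y)` (`exp(4 y)` if `p = 2`), given by the exponential series, on `ℂ_p`. -/
def expC (p : ℕ) [Fact p.Prime] (y : ℂ_[p]) : ℂ_[p] :=
  NormedSpace.exp ((expMul p : ℂ_[p]) * y)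

/-- `E_p` on `ℚ_p`; the series converges exactly on `ℤ_p`. -/
def expQ (p : ℕ) [Fact p.Prime] (x : ℚ_[p]) : ℚ_[p] :=
  NormedSpace.exp ((expMul p : ℚ_[p]) * x)

variable {p : ℕ} [Fact p.Prime]

/-- The degree `d = [ℚ_p(β) : ℚ_p]`. -/
def deg (β : ℂ_[p]) : ℕ := Module.finrank ℚ_[p] (IntermediateField.adjoin ℚ_[p] {β})

/-- `c` is the coordinate vector of `E_p(x β^j)` in the basis `1, β, …, β^(d-1)`
of `ℚ_p(β)` over `ℚ_p`. -/
def IsDecomposition (β : ℂ_[p]) (j : ℕ) (x : ℚ_[p]) (c : Fin (deg β) → ℚ_[p]) : Prop :=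
  expC p (algebraMap ℚ_[p] ℂ_[p] x * β ^ j) =
    ∑ i : Fin (deg β), algebraMap ℚ_[p] ℂ_[p] (c i) * β ^ (i : ℕ)

/-- The decomposition functions `c_{i,j}` of `E_p` in `ℚ_p(β)`:
`E_p(x β^j) = c_{0,j}(x) + c_{1,j}(x) β + ⋯ + c_{d-1,j}(x) β^(d-1)`.
The coordinates exist and are unique (`isDecomposition_decomp`, `IsDecomposition.eq_decomp`). -/
def decomp (β : ℂ_[p]) (i : Fin (deg β)) (j : ℕ) (x : ℚ_[p]) : ℚ_[p] :=
  Classical.epsilon (IsDecomposition β j x) i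

theorem deg_eq {β : ℂ_[p]} (hβ : IsIntegral ℚ_[p] β) : deg β = (minpoly ℚ_[p] β).natDegree :=
  IntermediateField.adjoin.finrank hβ

theorem pow_mem_span {β : ℂ_[p]} (hβ : IsIntegral ℚ_[p] β) (k : ℕ) :
    β ^ k ∈ Submodule.span ℚ_[p] (Set.range fun i : Fin (deg β) => β ^ (i : ℕ)) := by
  rw [PowerBasis.mem_span_pow']
  refine ⟨(Polynomial.X ^ k) %ₘ (minpoly ℚ_[p] β), ?_, ?_⟩
  · rw [deg_eq hβ]
    rw [← Polynomial.degree_eq_natDegree (minpoly.ne_zero hβ)]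
    exact Polynomial.degree_modByMonic_lt _ (minpoly.monic hβ)
  · rw [Polynomial.aeval_modByMonic_eq_self_of_root (minpoly.aeval _ _)]
    simp

theorem exists_isDecomposition {β : ℂ_[p]} (hβ : IsIntegral ℚ_[p] β) (j : ℕ) (x : ℚ_[p]) :
    ∃ c, IsDecomposition β j x c := by
  have hmem : expC p (algebraMap ℚ_[p] ℂ_[p] x * β ^ j) ∈
      Submodule.span ℚ_[p] (Set.range fun i : Fin (deg β) => β ^ (i : ℕ)) := by
    set S := Submodule.span ℚ_[p] (Set.range fun i : Fin (deg β) => β ^ (i : ℕ)) with hS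
    have : FiniteDimensional ℚ_[p] S :=
      FiniteDimensional.span_of_finite ℚ_[p] (Set.finite_range _)
    have hterm : ∀ k : ℕ, ((k.factorial : ℚ_[p])⁻¹) •
        ((expMul p : ℂ_[p]) * (algebraMap ℚ_[p] ℂ_[p] x * β ^ j)) ^ k ∈ S := by
      intro k
      have : ((k.factorial : ℚ_[p])⁻¹) •
          ((expMul p : ℂ_[p]) * (algebraMap ℚ_[p] ℂ_[p] x * β ^ j)) ^ k =
          (((k.factorial : ℚ_[p])⁻¹) * ((expMul p : ℚ_[p]) * x) ^ k) • β ^ (j * k) := by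
        simp only [Algebra.smul_def, map_mul, map_pow, map_natCast, mul_pow, pow_mul]
        ring
      rw [this]
      exact S.smul_mem _ (pow_mem_span hβ _)
    rw [expC, NormedSpace.exp_eq_tsum ℚ_[p]]
    exact tsum_mem (s := S) S.closed_of_finiteDimensional hterm
  obtain ⟨c, hc⟩ := (Submodule.mem_span_range_iff_exists_fun ℚ_[p]).1 hmem
  exact ⟨c, by simp only [IsDecomposition, ← hc, Algebra.smul_def]⟩

theorem isDecomposition_decomp {β : ℂ_[p]} (hβ : IsIntegral ℚ_[p] β) (j : ℕ) (x : ℚ_[p]) :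
    IsDecomposition β j x fun i => decomp β i j x :=
  Classical.epsilon_spec (exists_isDecomposition hβ j x)

theorem IsDecomposition.eq_decomp {β : ℂ_[p]} (hβ : IsIntegral ℚ_[p] β) {j : ℕ} {x : ℚ_[p]}
    {c : Fin (deg β) → ℚ_[p]} (hc : IsDecomposition β j x c) (i : Fin (deg β)) :
    c i = decomp β i j x := by
  have hli : LinearIndependent ℚ_[p] fun i : Fin (deg β) => β ^ (i : ℕ) := by
    rw [deg_eq hβ]
    exact linearIndependent_pow β
  have h := hc.symm.trans (isDecomposition_decomp hβ j x)
  simp only [← Algebra.smul_def] at h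
  have h0 : ∑ i, (c i - decomp β i j x) • β ^ (i : ℕ) = 0 := by
    simp only [sub_smul, Finset.sum_sub_distrib, h, sub_self]
  exact sub_eq_zero.1 (Fintype.linearIndependent_iff.1 hli _ h0 i)

/-- The indeterminates of the polynomial ring `ℤ[X̄, Ȳ₀, …, Ȳ_L]` with `L = d² - d`, where each
block consists of `n` indeterminates: `X k` is to be replaced by `x_k`, `E k` by `E_p(x_k)`, and
`C i j k` by `c_{i,j+1}(x_k)`, for `0 ≤ i ≤ d - 1` and `1 ≤ j + 1 ≤ d - 1`. -/
inductive Indet (n d : ℕ) : Type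
  | X (k : Fin n)
  | E (k : Fin n)
  | C (i : Fin d) (j : Fin (d - 1)) (k : Fin n)

/-- The values of the indeterminates at `x = (x₁, …, xₙ)`. -/
def indetValue (β : ℂ_[p]) {n : ℕ} (x : Fin n → ℚ_[p]) : Indet n (deg β) → ℚ_[p]
  | .X k => x k
  | .E k => expQ p (x k)
  | .C i j k => decomp β i ((j : ℕ) + 1) (x k)

/-- The function `F_P` attached to the polynomial `P`. Only its restriction to the open set
`ℤ_p^n ⊆ ℚ_p^n` is relevant. -/
def F (β : ℂ_[p]) {n : ℕ} (P : MvPolynomial (Indet n (deg β)) ℤ) (x : Fin n → ℚ_[p]) : ℚ_[p] :=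
  MvPolynomial.aeval (indetValue β x) P

/-- The inclusion `ℤ_p^n → ℚ_p^n`. -/
def incl {n : ℕ} (a : Fin n → ℤ_[p]) : Fin n → ℚ_[p] := fun k => (a k : ℚ_[p])

/-- The Jacobian matrix `(∂f_i/∂x_j)(a)`. -/
def jacobian {n : ℕ} (f : Fin n → (Fin n → ℚ_[p]) → ℚ_[p]) (a : Fin n → ℚ_[p]) :
    Matrix (Fin n) (Fin n) ℚ_[p] :=
  Matrix.of fun i j => fderiv ℚ_[p] (f i) a (Pi.single j 1)

/-- `a` is a non-singular zero of the square system `f`. -/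
def IsNonsingularZero {n : ℕ} (f : Fin n → (Fin n → ℚ_[p]) → ℚ_[p]) (a : Fin n → ℚ_[p]) : Prop :=
  (∀ i, f i a = 0) ∧ (jacobian f a).det ≠ 0

end PadicExp

end

/-! Call `q` a relation at `a` if `F_q(a) = 0`. Since the polynomial ring is Noetherian, some zero
`a` of `F_P` has a maximal ideal of relations among all zeros of `F_P`.

The gradients of the relations at this `a` span `ℚ_p^n` (`span_grad_eq_top_of_maximal`). Otherwise
all relations vanish on an analytic curve through `a` along which some coordinate is `a_k + t`
(`exists_curve_of_span_grad_ne_top`). This uses a ring of analytic functions closed under partial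
derivatives. A nearby point of the curve has a rational `k`-th coordinate different from `a_k`; it
satisfies every relation of `a` and one more, against maximality. The derivatives of the `c_{i,j}`
have coefficients in `ℚ[θ]` for an algebraic `θ ∈ ℚ_p`, so the ring is built over `ℚ[θ]`. By
separability of `θ`, `grad_mem_span` brings gradients back to integer polynomials.

Schanuel bounds the number of relations needed. The components of `a` are independent, so the `nd`
numbers `a_k β^i` are independent over `ℚ`. They and their exponentials are algebraic over the `(L +
2)n` values at `a` (`le_encard_of_schanuel`). At most `(L + 2)n - nd = T` values therefore lie
outside a transcendence basis. After inverting polynomials nonzero at `a`, that many elements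
generate the relations (`exists_local_generators`). Local generators have the same span of
gradients, so `n` of them have `a` as a non-singular zero. Local generation applied to the relation
`P` gives `R` and the `S_i`. -/

noncomputable section

/-! ### Commutative algebra: generating kernels of evaluations locally. -/

namespace PadicExp

open Polynomial

/-- The ideal `I` agrees with the kernel of `φ` after inverting the elements outside the kernel. -/
def IsLocalKer {A L : Type*} [CommRing A] [CommRing L] (φ : A →+* L) (I : Ideal A) : Prop :=
  (∀ f ∈ I, φ f = 0) ∧ ∀ f, φ f = 0 → ∃ g, φ g ≠ 0 ∧ g * f ∈ I

/-- Each coefficient has its own multiplier; their product serves all coefficients and stays nonzero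
because `L` is a field. -/
theorem exists_common_multiplier {A L : Type*} [CommRing A] [Field L] {φ : A →+* L} {I : Ideal A}
    (hI : IsLocalKer φ I) (f : A[X]) (hf : f.map φ = 0) :
    ∃ g, φ g ≠ 0 ∧ C g * f ∈ I.map C := by
  have hc : ∀ i, φ (f.coeff i) = 0 := fun i => by
    rw [← coeff_map, hf, coeff_zero]
  choose g hg hgI using fun i => hI.2 (f.coeff i) (hc i)
  refine ⟨∏ i ∈ f.support, g i, ?_, ?_⟩
  · rw [map_prod]
    exact Finset.prod_ne_zero_iff.2 fun i _ => hg i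
  · rw [Ideal.mem_map_C_iff]
    intro i
    rw [coeff_C_mul]
    by_cases hi : i ∈ f.support
    · rw [← Finset.prod_erase_mul _ _ hi, mul_assoc]
      exact I.mul_mem_left _ (hgI i)
    · rw [notMem_support_iff.1 hi, mul_zero]
      exact I.zero_mem

/-- Local generators of the kernel of an evaluation of `A[X]` at an element algebraic over `A`. -/
theorem exists_local_generator {A L : Type*} [CommRing A] [Field L] (Φ : A[X] →+* L) {I : Ideal A}
    (hI : IsLocalKer (Φ.comp C) I) (h : A[X]) (hh : Φ h = 0) (hh0 : h.map (Φ.comp C) ≠ 0) :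
    ∃ m, Φ m = 0 ∧ ∀ f, Φ f = 0 →
      ∃ g, Φ (C g) ≠ 0 ∧ C g * f ∈ Ideal.span {m} ⊔ I.map C := by
  classical
  set φ := Φ.comp C with hφ
  -- A witness `m` of least degree plays the part of a minimal polynomial of `Φ X`. Its leading
  -- coefficient survives under `φ`, since otherwise the leading term could be dropped; so
  -- pseudo-division by `m` costs only admissible multipliers.
  have hex : ∃ k, ∃ m : A[X], m.natDegree = k ∧ Φ m = 0 ∧ m.map φ ≠ 0 :=
    ⟨_, h, rfl, hh, hh0⟩
  obtain ⟨m, hmk, hm, hm0⟩ := Nat.find_spec hex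
  have hmin : ∀ f : A[X], Φ f = 0 → f.natDegree < m.natDegree → f.map φ = 0 := by
    intro f hf hlt
    by_contra h0
    exact Nat.find_min hex (hmk ▸ hlt) ⟨f, rfl, hf, h0⟩
  have hΦ : ∀ (c : A) (k : ℕ), Φ (C c * X ^ k) = φ c * Φ X ^ k := by
    intro c k
    simp [hφ]
  have hlc : φ m.leadingCoeff ≠ 0 := by
    intro h0
    have h1 : (C m.leadingCoeff * X ^ m.natDegree : A[X]).map φ = 0 := by simp [h0]
    have h2 : m.eraseLead.map φ ≠ 0 := by
      intro h3
      apply hm0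
      rw [← eraseLead_add_C_mul_X_pow m, Polynomial.map_add, h1, h3, add_zero]
    have h3 : Φ m.eraseLead = 0 := by
      have := hm
      rw [← eraseLead_add_C_mul_X_pow m, map_add, hΦ, h0, zero_mul, add_zero] at this
      exact this
    rcases m.eraseLead_natDegree_lt_or_eraseLead_eq_zero with h4 | h4
    · exact h2 (hmin _ h3 h4)
    · exact h2 (by rw [h4, Polynomial.map_zero])
  refine ⟨m, hm, fun f => ?_⟩
  induction hk : f.natDegree using Nat.strong_induction_on generalizing f with
  | _ k ih =>
  intro hf
  subst hk
  by_cases hlt : f.natDegree < m.natDegree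
  · obtain ⟨g, hg, hgI⟩ := exists_common_multiplier hI f (hmin f hf hlt)
    exact ⟨g, hg, Ideal.mem_sup_right hgI⟩
  · push Not at hlt
    -- Pseudo-division lowers `natDegree` strictly only from positive degree. In degree zero `m`
    -- would be a constant killed by `Φ`, contradicting `hlc`.
    by_cases hfd : f.natDegree = 0
    · have hm' : m.natDegree = 0 := by omega
      exfalso
      rw [natDegree_eq_zero] at hm'
      obtain ⟨c, rfl⟩ := hm'
      apply hlc
      rw [leadingCoeff_C]
      exact hm
    set q : A[X] := C f.leadingCoeff * X ^ (f.natDegree - m.natDegree) with hq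
    set r := C m.leadingCoeff * f - q * m with hr
    have hr0 : Φ r = 0 := by simp [hr, hf, hm]
    have hrd : r.natDegree < f.natDegree := by
      have hle : r.natDegree ≤ f.natDegree := by
        refine (natDegree_sub_le _ _).trans (max_le (natDegree_C_mul_le _ _) ?_)
        refine natDegree_mul_le.trans ?_
        have := natDegree_C_mul_X_pow_le f.leadingCoeff (f.natDegree - m.natDegree)
        rw [← hq] at this
        omega
      have hc : r.coeff f.natDegree = 0 := by
        have h1 : (q * m).coeff f.natDegree = f.leadingCoeff * m.leadingCoeff := by
          rw [hq, mul_assoc, coeff_C_mul, coeff_X_pow_mul', if_pos (Nat.sub_le _ _)]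
          congr 2
          omega
        rw [hr, coeff_sub, coeff_C_mul, h1, coeff_natDegree]
        ring
      refine lt_of_le_of_ne hle fun h => hfd ?_
      have : r = 0 := by
        rw [← leadingCoeff_eq_zero, leadingCoeff, h, hc]
      rw [← h, this, natDegree_zero]
    obtain ⟨g, hg, hgI⟩ := ih _ hrd r rfl hr0
    refine ⟨g * m.leadingCoeff, ?_, ?_⟩
    · rw [C_mul, map_mul]
      exact mul_ne_zero hg hlc
    · have : C (g * m.leadingCoeff) * f = C g * r + C g * q * m := by
        rw [hr, C_mul]
        ring
      rw [this]
      exact Ideal.add_mem _ hgI (Ideal.mem_sup_left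
        (Ideal.mul_mem_left _ _ (Ideal.mem_span_singleton_self m)))

/-- Local kernels are transported by ring isomorphisms. -/
theorem IsLocalKer.of_equiv {A A' L : Type*} [CommRing A] [CommRing A'] [Field L] (e : A ≃+* A')
    {φ : A →+* L} {φ' : A' →+* L} (h : ∀ x, φ' (e x) = φ x) {τ : Type*} {r : τ → A}
    (hI : IsLocalKer φ (Ideal.span (Set.range r))) :
    IsLocalKer φ' (Ideal.span (Set.range (e ∘ r))) := by
  have hmap : (Ideal.span (Set.range r)).map (e : A →+* A') = Ideal.span (Set.range (e ∘ r)) := by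
    rw [Ideal.map_span, ← Set.range_comp]
    rfl
  constructor
  · intro f hf
    have : Ideal.span (Set.range (e ∘ r)) ≤ RingHom.ker φ' := by
      rw [Ideal.span_le]
      rintro _ ⟨i, rfl⟩
      exact (h _).trans (hI.1 _ (Ideal.subset_span ⟨i, rfl⟩))
    exact this hf
  · intro f hf
    obtain ⟨f, rfl⟩ := e.surjective f
    obtain ⟨g, hg, hgI⟩ := hI.2 f ((h f).symm.trans hf)
    refine ⟨e g, by rwa [h], ?_⟩
    rw [← map_mul, ← hmap]
    exact Ideal.mem_map_of_mem (e : A →+* A') hgI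

/-- If `φ` is injective on the coefficient ring `A` and every variable is sent to an element
algebraic over `A`, then the kernel of `φ` is locally generated by as many elements as there are
variables. -/
theorem exists_local_generators {A L : Type*} [CommRing A] [Field L] [Algebra A L]
    (hinj : Function.Injective (algebraMap A L)) (τ : Type) [Finite τ] :
    ∀ z : τ → L, (∀ i, IsAlgebraic A (z i)) →
      ∃ r : τ → MvPolynomial τ A,
        IsLocalKer (MvPolynomial.aeval z : MvPolynomial τ A →ₐ[A] L).toRingHom
          (Ideal.span (Set.range r)) := by
  induction τ using Finite.induction_empty_option with
  | @of_equiv α γ e ih =>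
    intro z hz
    obtain ⟨r, hr⟩ := ih (z ∘ e) fun i => hz _
    have := hr.of_equiv (MvPolynomial.renameEquiv A e).toRingEquiv
      (φ' := (MvPolynomial.aeval z : MvPolynomial γ A →ₐ[A] L).toRingHom)
      (fun x => by simp [MvPolynomial.aeval_rename])
    refine ⟨(MvPolynomial.renameEquiv A e).toRingEquiv ∘ r ∘ e.symm, ?_⟩
    rwa [← Function.comp_assoc, e.symm.surjective.range_comp]
  | h_empty =>
    intro z _
    refine ⟨fun i => 0, ⟨fun f hf => ?_, fun f hf => ⟨1, by simp, ?_⟩⟩⟩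
    · have : Ideal.span (Set.range fun _ : PEmpty => (0 : MvPolynomial PEmpty A)) = ⊥ := by
        simp
      rw [this] at hf
      rw [(Submodule.mem_bot _).1 hf, map_zero]
    · obtain ⟨a, rfl⟩ := MvPolynomial.C_surjective PEmpty f
      have : algebraMap A L a = 0 := by simpa using hf
      rw [(map_eq_zero_iff _ hinj).1 this]
      simp
  | @h_option α _ ih =>
    intro z hz
    obtain ⟨r, hr⟩ := ih (fun i => z (some i)) fun i => hz _
    -- The new variable becomes the variable of a one-variable polynomial ring over the old ones,
    -- and contributes the single generator `m`.
    set e := (MvPolynomial.optionEquivLeft A α).symm.toRingEquiv with he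
    set Φ : (MvPolynomial α A)[X] →+* L :=
      (MvPolynomial.aeval z : MvPolynomial (Option α) A →ₐ[A] L).toRingHom.comp e.toRingHom with hΦ
    have hΦC : Φ.comp C =
        (MvPolynomial.aeval (fun i => z (some i)) : MvPolynomial α A →ₐ[A] L).toRingHom := by
      refine MvPolynomial.ringHom_ext (fun a => ?_) (fun i => ?_)
      · simp [hΦ, he]
      · simp [hΦ, he]
    obtain ⟨h, h0, hz0⟩ := hz none
    have hmapC : (Φ.comp C).comp MvPolynomial.C = algebraMap A L := by
      ext a
      rw [hΦC]
      simp
    have hΦX : Φ X = z none := by simp [hΦ, he]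
    have hΦh : Φ (h.map MvPolynomial.C) = 0 := by
      have : Φ.comp (Polynomial.mapRingHom MvPolynomial.C) = (aeval (z none)).toRingHom := by
        refine Polynomial.ringHom_ext (fun a => ?_) ?_
        · simpa using congrArg (fun f => f a) hmapC
        · simpa using hΦX
      exact (congrArg (fun f => f h) this).trans hz0
    obtain ⟨m, hm, hmg⟩ := exists_local_generator Φ (hΦC ▸ hr) (h.map MvPolynomial.C) hΦh (by
      rw [Polynomial.map_map, hmapC]
      exact (Polynomial.map_ne_zero_iff hinj).2 h0)
    set r' : Option α → (MvPolynomial α A)[X] := fun o => o.elim m fun i => C (r i) with hr'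
    have hspan : Ideal.span {m} ⊔ (Ideal.span (Set.range r)).map C =
        Ideal.span (Set.range r') := by
      rw [Ideal.map_span, ← Ideal.span_union, ← Set.range_comp]
      congr 1
      ext x
      simp [hr', Option.exists, eq_comm]
    have hloc : IsLocalKer Φ (Ideal.span (Set.range r')) := by
      refine ⟨fun f hf => ?_, fun f hf => ?_⟩
      · have : Ideal.span (Set.range r') ≤ RingHom.ker Φ := by
          rw [Ideal.span_le]
          rintro _ ⟨o, rfl⟩
          cases o with
          | none => exact hm
          | some i =>
            have h1 := hr.1 _ (Ideal.subset_span ⟨i, rfl⟩)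
            rw [← hΦC] at h1
            exact h1
        exact this hf
      · obtain ⟨g, hg, hgI⟩ := hmg f hf
        exact ⟨C g, hg, hspan ▸ hgI⟩
    exact ⟨_, hloc.of_equiv e fun x => rfl⟩

/-- The relations between finitely many elements of a field are locally generated by as many
relations as there are elements outside a transcendence basis. -/
theorem exists_local_generators_compl {L : Type*} [Field L] [Algebra ℤ L] {ι : Type} [Finite ι]
    (z : ι → L) (s : Set ι) (hs : AlgebraicIndependent ℤ fun i : s => z i)
    (halg : ∀ i, IsAlgebraic (Algebra.adjoin ℤ (Set.range fun i : s => z i)) (z i)) :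
    ∃ r : (sᶜ : Set ι) → MvPolynomial ι ℤ,
      IsLocalKer (MvPolynomial.aeval z : MvPolynomial ι ℤ →ₐ[ℤ] L).toRingHom
        (Ideal.span (Set.range r)) := by
  classical
  -- The variables of the transcendence basis become coefficients: `A` embeds in `L`, and the
  -- remaining values are algebraic over it.
  let A := MvPolynomial s ℤ
  let φ : A →ₐ[ℤ] L := MvPolynomial.aeval fun i : s => z i
  let : Algebra A L := φ.toRingHom.toAlgebra
  have hinj : Function.Injective (algebraMap A L) := hs
  have halg' : ∀ i : (sᶜ : Set ι), IsAlgebraic A (z i) := by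
    intro i
    obtain ⟨q, hq0, hq⟩ := halg i
    let e : A ≃ₐ[ℤ] Algebra.adjoin ℤ (Set.range fun i : s => z i) := hs.aevalEquiv
    refine ⟨q.map e.symm.toRingEquiv.toRingHom,
      (Polynomial.map_ne_zero_iff e.symm.injective).2 hq0, ?_⟩
    have : (algebraMap A L).comp e.symm.toRingEquiv.toRingHom =
        algebraMap (Algebra.adjoin ℤ (Set.range fun i : s => z i)) L := by
      ext c
      obtain ⟨b, rfl⟩ := e.surjective c
      have h1 : algebraMap A L b = φ b := rfl
      simp only [RingHom.comp_apply]
      have h2 : e.symm.toRingEquiv.toRingHom (e b) = b := e.symm_apply_apply b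
      rw [h2, h1]
      exact (hs.algebraMap_aevalEquiv b).symm
    rw [aeval_def, eval₂_map, this]
    exact hq
  obtain ⟨r, hr⟩ := exists_local_generators hinj (sᶜ : Set ι) (fun i => z i) halg'
  let e1 : MvPolynomial (sᶜ : Set ι) A ≃ₐ[ℤ] MvPolynomial ((sᶜ : Set ι) ⊕ s) ℤ :=
    (MvPolynomial.sumAlgEquiv ℤ (sᶜ : Set ι) s).symm
  let e2 : MvPolynomial ((sᶜ : Set ι) ⊕ s) ℤ ≃ₐ[ℤ] MvPolynomial ι ℤ :=
    MvPolynomial.renameEquiv ℤ ((Equiv.sumComm _ _).trans (Equiv.Set.sumCompl s))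
  have := hr.of_equiv (e1.trans e2).toRingEquiv
    (φ' := (MvPolynomial.aeval z : MvPolynomial ι ℤ →ₐ[ℤ] L).toRingHom) (by
      intro x
      have hy : ((MvPolynomial.aeval z : MvPolynomial ι ℤ →ₐ[ℤ] L).toRingHom.comp
          e2.toRingEquiv.toRingHom) = (MvPolynomial.aeval
            (fun i : (sᶜ : Set ι) => z i) : MvPolynomial (sᶜ : Set ι) A →ₐ[A] L).toRingHom.comp
          (MvPolynomial.sumAlgEquiv ℤ (sᶜ : Set ι) s).toRingEquiv.toRingHom := by
        refine MvPolynomial.ringHom_ext (fun a => by simp) (fun i => ?_)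
        cases i with
        | inl i => simp [e2]
        | inr i =>
          have h1 : algebraMap A L (MvPolynomial.X i) = z i := MvPolynomial.aeval_X _ i
          simp [e2, h1]
      simpa [e1] using congrArg (fun f => f (e1 x)) hy)
  exact ⟨_, this⟩

/-- A separable extension of the ring of constants does not change the kernel locally. -/
theorem exists_multiplier_mem_map_sup {A L : Type*} [CommRing A] [Field L] (Φ : A[X] →+* L)
    {I : Ideal A} (hI : IsLocalKer (Φ.comp C) I) (μ : A[X]) (hμ : Φ μ = 0)
    (hμ' : Φ (derivative μ) ≠ 0) (F : A[X]) (hF : Φ F = 0) :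
    ∃ G, Φ G ≠ 0 ∧ G * F ∈ I.map C ⊔ Ideal.span {μ} := by
  have hIC : ∀ q ∈ I.map C, Φ q = 0 := by
    intro q hq
    have : I.map C ≤ RingHom.ker Φ := by
      rw [Ideal.map_le_iff_le_comap]
      exact hI.1
    exact this hq
  have hΦ : ∀ f : A[X], Φ f = (f.map (Φ.comp C)).eval (Φ X) := by
    intro f
    have : Φ = (evalRingHom (Φ X)).comp (mapRingHom (Φ.comp C)) :=
      ringHom_ext (fun a => by simp) (by simp)
    exact congrArg (fun g => g f) this
  have hμ0 : μ.map (Φ.comp C) ≠ 0 := by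
    intro h0
    apply hμ'
    rw [hΦ, ← derivative_map, h0]
    simp
  obtain ⟨m, hm, hmg⟩ := exists_local_generator Φ hI μ hμ hμ0
  obtain ⟨g, hg, hgμ⟩ := hmg μ hμ
  obtain ⟨g', hg', hgF⟩ := hmg F hF
  obtain ⟨k', hk', q, hq, hkq⟩ := Submodule.mem_sup.1 hgμ
  obtain ⟨h', hh', q', hq', hhq⟩ := Submodule.mem_sup.1 hgF
  obtain ⟨k, rfl⟩ := Ideal.mem_span_singleton'.1 hk'
  obtain ⟨h, rfl⟩ := Ideal.mem_span_singleton'.1 hh'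
  have hdq : Φ (derivative q) = 0 := by
    apply hIC
    rw [Ideal.mem_map_C_iff] at hq ⊢
    intro n
    rw [coeff_derivative]
    exact I.mul_mem_right _ (hq _)
  -- Differentiating `k * m + q = C g * μ` and applying `Φ` leaves `Φ k * Φ m' = Φ g * Φ μ'`, whose
  -- right side is nonzero. Hence `m` can be traded for `μ` at the price of the multiplier `k`.
  have hk : Φ k ≠ 0 := by
    intro hk0
    have := congrArg (fun f => Φ (derivative f)) hkq
    simp only [derivative_mul, map_add, map_mul, hm, hk0, hdq, derivative_C,
      zero_mul, mul_zero, add_zero, zero_add] at this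
    exact mul_ne_zero hg hμ' this.symm
  refine ⟨k * C g', ?_, ?_⟩
  · rw [map_mul]
    exact mul_ne_zero hk hg'
  · have : k * C g' * F = (k * q' - h * q) + h * C g * μ := by
      linear_combination h * hkq - k * hhq
    rw [this]
    exact Ideal.add_mem _
      (Ideal.mem_sup_left (Ideal.sub_mem _ (Ideal.mul_mem_left _ _ hq') (Ideal.mul_mem_left _ _ hq)))
      (Ideal.mem_sup_right (Ideal.mul_mem_left _ _ (Ideal.mem_span_singleton_self μ)))

end PadicExp

/-! ### Analytic curves on which a differentially closed ring vanishes. -/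

namespace PadicExp

open Filter Topology

/-- A family of vectors that does not span can be completed to a basis by vectors of a spanning
family in such a way that it stays in the span of the other basis vectors. -/
theorem exists_frame {K E J : Type*} [Field K] [AddCommGroup E] [Module K E]
    [FiniteDimensional K E] {n : ℕ} (hn : Module.finrank K E = n) (v : J → E) (Z W : Set J)
    (hW : Submodule.span K (v '' W) = ⊤) (hZ : Submodule.span K (v '' Z) ≠ ⊤) :
    ∃ (g : Fin n → J) (i₀ : Fin n), g i₀ ∈ W ∧ LinearIndependent K (v ∘ g) ∧
      ∀ f ∈ Z, v f ∈ Submodule.span K ((v ∘ g) '' {i₀}ᶜ) := by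
  obtain ⟨b₀, hb₀Z, -, hZb₀, hb₀⟩ :=
    exists_linearIndepOn_extension (linearIndepOn_empty K v) (Set.empty_subset Z)
  obtain ⟨b, hbt, hb₀b, htb, hb⟩ :=
    exists_linearIndepOn_extension hb₀ (hb₀Z.trans Set.subset_union_left : b₀ ⊆ Z ∪ W)
  have hspan : Submodule.span K (v '' b) = ⊤ := by
    rw [eq_top_iff, ← hW, Submodule.span_le]
    exact (Set.image_mono Set.subset_union_right).trans htb
  have hspan' : ⊤ ≤ Submodule.span K (Set.range fun i : b => v i) := by
    rw [← hspan, Set.image_eq_range]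
  let B : Module.Basis b K E := Module.Basis.mk hb hspan'
  have : Fintype b := FiniteDimensional.fintypeBasisIndex B
  have hcard : Fintype.card b = n := by rw [← hn, Module.finrank_eq_card_basis B]
  let e : Fin n ≃ b := (Fintype.equivFinOfCardEq hcard).symm
  -- `b₀` is a basis of the span of `Z`, which is proper, so the basis `b` has a further member. It
  -- comes from `W`, since a member of `Z` would depend on `b₀`.
  obtain ⟨h, hhb, hhb₀⟩ : ∃ h ∈ b, h ∉ b₀ := by
    by_contra! hcon
    refine hZ (eq_top_iff.2 ?_)
    rw [← hspan]
    exact Submodule.span_mono (Set.image_mono fun x hx => hb₀Z (hcon x hx))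
  have hsub : v '' b₀ ⊆ v '' (b \ {h}) :=
    Set.image_mono fun x hx => ⟨hb₀b hx, fun hxh => hhb₀ (hxh ▸ hx)⟩
  have hnot : v h ∉ Submodule.span K (v '' (b \ {h})) :=
    (linearIndepOn_iff_notMem_span.1 hb) h hhb
  have hrange : v '' (b \ {h}) ⊆ (v ∘ fun i => (e i : J)) '' {e.symm ⟨h, hhb⟩}ᶜ := by
    rintro _ ⟨x, ⟨hxb, hxh⟩, rfl⟩
    refine ⟨e.symm ⟨x, hxb⟩, ?_, by simp⟩
    simpa using hxh
  refine ⟨fun i => e i, e.symm ⟨h, hhb⟩, ?_, hb.comp e e.injective, fun f hf => ?_⟩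
  · simp only [Equiv.apply_symm_apply]
    rcases hbt hhb with hhZ | hhW
    · exact absurd (Submodule.span_mono hsub (hZb₀ ⟨h, hhZ, rfl⟩)) hnot
    · exact hhW
  · exact Submodule.span_mono (hsub.trans hrange) (hZb₀ ⟨f, hf, rfl⟩)

/-- The gradient of a function of `n` variables. -/
def grad {K : Type*} [NontriviallyNormedField K] {n : ℕ} (f : (Fin n → K) → K) (x : Fin n → K) :
    Fin n → K :=
  fun l => fderiv K f x (Pi.single l 1)

theorem fderiv_eq_sum_grad {K : Type*} [NontriviallyNormedField K] {n : ℕ} (f : (Fin n → K) → K)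
    (x w : Fin n → K) : fderiv K f x w = ∑ l, grad f x l * w l := by
  conv_lhs => rw [← Finset.univ_sum_single w]
  rw [map_sum]
  refine Finset.sum_congr rfl fun l _ => ?_
  have : Pi.single l (w l) = w l • (Pi.single l 1 : Fin n → K) := by
    rw [← Pi.single_smul, smul_eq_mul, mul_one]
  rw [this, map_smul, smul_eq_mul, mul_comm]
  rfl

/-- Coordinates adapted to `n` analytic functions with independent gradients: there is an analytic
curve along which all but one of the functions are constant, and the last one has slope `1`. -/
theorem exists_coordinate_curve {K : Type*} [NontriviallyNormedField K] [CompleteSpace K] {n : ℕ}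
    (g : Fin n → (Fin n → K) → K) (a : Fin n → K) (hg : ∀ i, AnalyticAt K (g i) a)
    (hli : LinearIndependent K fun i => grad (g i) a) (i₀ : Fin n) :
    ∃ γ : K → Fin n → K, γ 0 = a ∧ AnalyticAt K γ 0 ∧
      ∀ᶠ t in 𝓝 0, ∀ i, g i (γ t) = g i a + if i = i₀ then t else 0 := by
  let Φ : (Fin n → K) → Fin n → K := fun x i => g i x
  have hΦ : AnalyticAt K Φ a := AnalyticAt.pi hg
  have hfd : ∀ w i, fderiv K Φ a w i = ∑ l, grad (g i) a l * w l := by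
    intro w i
    rw [fderiv_pi fun i => (hg i).differentiableAt]
    exact fderiv_eq_sum_grad _ _ _
  have hunit : IsUnit (Matrix.of fun i => grad (g i) a) :=
    Matrix.linearIndependent_rows_iff_isUnit.1 hli
  have hinj : Function.Injective (fderiv K Φ a) := by
    have : ⇑(fderiv K Φ a) = (Matrix.of fun i => grad (g i) a).mulVec := by
      ext w i
      rw [hfd]
      rfl
    rw [this]
    exact Matrix.mulVec_injective_of_isUnit hunit
  let e : (Fin n → K) ≃L[K] (Fin n → K) :=
    (LinearEquiv.ofInjectiveEndo (fderiv K Φ a).toLinearMap hinj).toContinuousLinearEquiv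
  have he : fderiv K Φ a = e := by
    ext w
    rfl
  have hs : HasStrictFDerivAt Φ (e : (Fin n → K) →L[K] (Fin n → K)) a := by
    rw [← he]
    exact hΦ.hasStrictFDerivAt
  let H := hs.toOpenPartialHomeomorph Φ
  have hH : AnalyticAt K H.symm (Φ a) :=
    H.analyticAt_symm' hs.mem_toOpenPartialHomeomorph_source hΦ he
  -- The curve is the preimage of this line under the local analytic inverse of `Φ`.
  let ℓ : K → Fin n → K := fun t => Φ a + t • Pi.single i₀ 1
  have hℓ : AnalyticAt K ℓ 0 := by fun_prop
  have hℓ0 : ℓ 0 = Φ a := by simp [ℓ]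
  refine ⟨H.symm ∘ ℓ, ?_, ?_, ?_⟩
  · rw [Function.comp_apply, hℓ0]
    exact H.left_inv hs.mem_toOpenPartialHomeomorph_source
  · exact (hℓ0 ▸ hH).comp hℓ
  · have hev : ∀ᶠ t in 𝓝 0, ℓ t ∈ H.target :=
      hℓ.continuousAt.eventually_mem
        (H.open_target.mem_nhds (hℓ0 ▸ hs.image_mem_toOpenPartialHomeomorph_target))
    filter_upwards [hev] with t ht i
    have := congrFun (H.right_inv ht) i
    refine this.trans ?_
    by_cases hi : i = i₀
    · subst hi
      simp [ℓ, Φ]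
    · simp [ℓ, Φ, hi]

/-- Let `𝓑` be a ring of analytic functions closed under partial derivatives. If the gradients of
the functions in `𝓑` vanishing at `a` do not span, then these functions vanish on an analytic curve
through `a` along which some coordinate is a uniformizing parameter. -/
theorem exists_curve_of_span_grad_ne_top {K : Type*} [NontriviallyNormedField K] [CompleteSpace K]
    [CharZero K] {n : ℕ} {U : Set (Fin n → K)} (hU : IsOpen U) (𝓑 : Subring ((Fin n → K) → K))
    (han : ∀ f ∈ 𝓑, ∀ x ∈ U, AnalyticAt K f x)
    (hder : ∀ f ∈ 𝓑, ∀ l, ∃ f' ∈ 𝓑, ∀ x ∈ U, f' x = grad f x l)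
    (hproj : ∀ k, (fun x : Fin n → K => x k) ∈ 𝓑) {a : Fin n → K} (ha : a ∈ U)
    (hspan : Submodule.span K ((fun f => grad f a) '' {f | f ∈ 𝓑 ∧ f a = 0}) ≠ ⊤) :
    ∃ (k : Fin n) (γ : K → Fin n → K), γ 0 = a ∧ ContinuousAt γ 0 ∧
      (∀ᶠ t in 𝓝 0, γ t k = a k + t) ∧ ∀ f ∈ 𝓑, f a = 0 → ∀ᶠ t in 𝓝 0, f (γ t) = 0 := by
  choose δ hδ𝓑 hδ using fun f : 𝓑 => hder f f.2
  let dd : 𝓑 → Fin n → 𝓑 := fun f l => ⟨δ f l, hδ𝓑 f l⟩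
  let ev : (Fin n → K) → 𝓑 →+* K := fun x => (Pi.evalRingHom _ x).comp 𝓑.subtype
  have hev : ∀ x ∈ U, ∀ f l, ev x (dd f l) = grad (f : (Fin n → K) → K) x l :=
    fun x hx f l => hδ f l x hx
  let Z : Set 𝓑 := {f | (f : (Fin n → K) → K) a = 0}
  let W : Set 𝓑 := Set.range fun k => ⟨fun x : Fin n → K => x k, hproj k⟩
  have hW : Submodule.span K ((fun f : 𝓑 => grad (f : (Fin n → K) → K) a) '' W) = ⊤ := by
    rw [eq_top_iff, ← (Pi.basisFun K (Fin n)).span_eq, Submodule.span_le]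
    rintro _ ⟨k, rfl⟩
    refine Submodule.subset_span ⟨_, ⟨k, rfl⟩, ?_⟩
    ext l
    have : fderiv K (fun x : Fin n → K => x k) a = ContinuousLinearMap.proj k :=
      (ContinuousLinearMap.proj (R := K) (φ := fun _ : Fin n => K) k).fderiv
    simp only [grad, this, Pi.basisFun_apply, ContinuousLinearMap.proj_apply, Pi.single_apply]
    exact if_congr eq_comm rfl rfl
  have hZ : Submodule.span K ((fun f : 𝓑 => grad (f : (Fin n → K) → K) a) '' Z) ≠ ⊤ := by
    convert hspan using 2
    ext w
    constructor
    · rintro ⟨f, hf, rfl⟩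
      exact ⟨f, ⟨f.2, hf⟩, rfl⟩
    · rintro ⟨f, ⟨hf, hf0⟩, rfl⟩
      exact ⟨⟨f, hf⟩, hf0, rfl⟩
  obtain ⟨g, i₀, ⟨k, hk⟩, hli, hgZ⟩ := exists_frame (n := n) (by simp) _ Z W hW hZ
  obtain ⟨γ, hγ0, hγ, hγg⟩ := exists_coordinate_curve
    (fun i => (g i : (Fin n → K) → K)) a (fun i => han _ (g i).2 a ha) hli i₀
  let M : Matrix (Fin n) (Fin n) 𝓑 := Matrix.of fun i => dd (g i)
  -- In the coordinates `g i` this is `det M` times the partial derivative along `g i₀`. The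
  -- adjugate avoids division, so `D` stays inside `𝓑`.
  let D : 𝓑 → 𝓑 := fun f => ∑ l, dd f l * M.adjugate l i₀
  have hMadj : ∀ x, ∀ i, ∑ l, ev x (M i l) * ev x (M.adjugate l i₀) =
      if i = i₀ then ev x M.det else 0 := by
    intro x i
    have := congrArg (ev x) (congrFun (congrFun M.mul_adjugate i) i₀)
    rw [Matrix.mul_apply, map_sum] at this
    simp only [map_mul] at this
    rw [this, Matrix.smul_apply, Matrix.one_apply]
    split_ifs <;> simp
  have hdet : ev a M.det ≠ 0 := by
    rw [RingHom.map_det]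
    have : (ev a).mapMatrix M = Matrix.of fun i => grad (g i : (Fin n → K) → K) a := by
      ext i l
      exact hev a ha _ _
    rw [this]
    exact ((Matrix.isUnit_iff_isUnit_det _).1 (Matrix.linearIndependent_rows_iff_isUnit.1 hli)).ne_zero
  -- At `a`, the gradient of `f ∈ Z` is a combination of those of `g i` with `i ≠ i₀`, and the
  -- column of the adjugate is orthogonal to them.
  have hD : ∀ f ∈ Z, D f ∈ Z := by
    intro f hf
    let ψ : (Fin n → K) →ₗ[K] K := Fintype.linearCombination K fun l => ev a (M.adjugate l i₀)
    have hψ : Submodule.span K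
        (((fun f : 𝓑 => grad (f : (Fin n → K) → K) a) ∘ g) '' {i₀}ᶜ) ≤ LinearMap.ker ψ := by
      rw [Submodule.span_le]
      rintro _ ⟨i, hi, rfl⟩
      have := hMadj a i
      rw [if_neg (by simpa using hi)] at this
      simp only [SetLike.mem_coe, LinearMap.mem_ker, ψ, Fintype.linearCombination_apply,
        Function.comp_apply, smul_eq_mul]
      rw [← this]
      exact Finset.sum_congr rfl fun l _ => by rw [← hev a ha]; rfl
    have h1 : ψ (grad (f : (Fin n → K) → K) a) = 0 := hψ (hgZ f hf)
    have h2 : ev a (D f) = 0 := by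
      rw [← h1, map_sum]
      simp only [ψ, Fintype.linearCombination_apply, smul_eq_mul]
      exact Finset.sum_congr rfl fun l _ => by rw [map_mul, hev a ha]
    exact h2
  have hγU : ∀ᶠ t in 𝓝 0, γ t ∈ U :=
    hγ.continuousAt.eventually_mem (hU.mem_nhds (hγ0 ▸ ha))
  have hcomp : ∀ f : 𝓑, AnalyticAt K (fun t => ev (γ t) f) 0 := fun f =>
    (hγ0 ▸ han f f.2 a ha : AnalyticAt K (f : (Fin n → K) → K) (γ 0)).comp hγ
  have hderiv : ∀ f : 𝓑, ∀ᶠ t in 𝓝 0,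
      ev (γ t) M.det * deriv (fun t => ev (γ t) f) t = ev (γ t) (D f) := by
    intro f
    filter_upwards [hγU, hγ.eventually_analyticAt, hγg.eventually_nhds] with t htU hta htg
    have hdt : HasDerivAt γ (deriv γ t) t := hta.differentiableAt.hasDerivAt
    have hchain : ∀ f : 𝓑, HasDerivAt (fun t => ev (γ t) f)
        (∑ l, ev (γ t) (dd f l) * deriv γ t l) t := by
      intro f
      have h1 := ((han f f.2 _ htU).differentiableAt.hasFDerivAt).comp_hasDerivAt t hdt
      rw [fderiv_eq_sum_grad] at h1
      simp only [hev _ htU]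
      exact h1
    have hone : ∀ i, ∑ l, ev (γ t) (M i l) * deriv γ t l = if i = i₀ then 1 else 0 := by
      intro i
      refine (hchain (g i)).unique ?_
      have h1 : HasDerivAt (fun s : K => (g i : (Fin n → K) → K) a + if i = i₀ then s else 0)
          (if i = i₀ then 1 else 0) t := by
        split_ifs
        · exact (hasDerivAt_id t).const_add _
        · exact hasDerivAt_const _ _
      refine h1.congr_of_eventuallyEq ?_
      filter_upwards [htg] with s hs
      exact hs i
    have hadj : ∀ l, ev (γ t) M.det * deriv γ t l = ev (γ t) (M.adjugate l i₀) := by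
      intro l
      have h1 : ∀ j, ∑ i, ev (γ t) (M.adjugate l i) * ev (γ t) (M i j) =
          if l = j then ev (γ t) M.det else 0 := by
        intro j
        have := congrArg (ev (γ t)) (congrFun (congrFun M.adjugate_mul l) j)
        rw [Matrix.mul_apply, map_sum] at this
        simp only [map_mul] at this
        rw [this, Matrix.smul_apply, Matrix.one_apply]
        split_ifs <;> simp
      calc ev (γ t) M.det * deriv γ t l
          = ∑ j, (∑ i, ev (γ t) (M.adjugate l i) * ev (γ t) (M i j)) * deriv γ t j := by
            simp [h1]
        _ = ∑ i, ev (γ t) (M.adjugate l i) * ∑ j, ev (γ t) (M i j) * deriv γ t j := by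
            simp only [Finset.sum_mul, Finset.mul_sum, mul_assoc]
            exact Finset.sum_comm
        _ = ev (γ t) (M.adjugate l i₀) := by simp [hone]
    rw [(hchain f).deriv, Finset.mul_sum, map_sum]
    refine Finset.sum_congr rfl fun l _ => ?_
    rw [map_mul, ← hadj]
    ring
  refine ⟨k, γ, hγ0, hγ.continuousAt, ?_, ?_⟩
  · filter_upwards [hγg] with t ht
    have := ht i₀
    rw [← hk, if_pos rfl] at this
    exact this
  · intro f hf𝓑 hfa
    by_contra hf
    -- Descent on the order of vanishing along `γ`: the least finite order in `Z` is positive, and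
    -- `D` lowers it by exactly one, since `det M` is a unit at `a` and the characteristic is zero.
    have hex : ∃ m : ℕ, ∃ f ∈ Z, analyticOrderAt (fun t => ev (γ t) f) 0 = m := by
      obtain ⟨m, hm⟩ := ENat.ne_top_iff_exists.1
        (fun h => hf (analyticOrderAt_eq_top.1 h) :
          analyticOrderAt (fun t => ev (γ t) ⟨f, hf𝓑⟩) 0 ≠ ⊤)
      exact ⟨m, _, hfa, hm.symm⟩
    classical
    obtain ⟨f, hfZ, hfm⟩ := Nat.find_spec hex
    have hf0 : ev (γ 0) f = 0 := by
      rw [hγ0]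
      exact hfZ
    have hpos : Nat.find hex ≠ 0 := by
      intro h0
      rw [h0, Nat.cast_zero, (hcomp f).analyticOrderAt_eq_zero] at hfm
      exact hfm hf0
    obtain ⟨m, hm⟩ := Nat.exists_eq_succ_of_ne_zero hpos
    refine Nat.find_min hex (m := m) (by omega) ⟨D f, hD f hfZ, ?_⟩
    rw [hm] at hfm
    have h1 : analyticOrderAt (deriv fun t => ev (γ t) f) 0 = m :=
      analyticOrderAt_deriv_of_pos (hcomp f) (by rw [hfm]; push_cast; rfl)
    have h2 : analyticOrderAt (fun t => ev (γ t) M.det) 0 = 0 := by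
      rw [(hcomp _).analyticOrderAt_eq_zero, hγ0]
      exact hdet
    have h3 : (fun t => ev (γ t) (D f)) =ᶠ[𝓝 0]
        (fun t => ev (γ t) M.det) * deriv fun t => ev (γ t) f := by
      filter_upwards [hderiv f] with t ht
      exact ht.symm
    rw [analyticOrderAt_congr h3, analyticOrderAt_mul (hcomp _) (hcomp f).deriv, h1, h2, zero_add]

end PadicExp

/-! ### The `p`-adic exponential, the decomposition functions and their derivatives. -/

namespace PadicExp

open Filter Topology
open scoped IntermediateField NNReal ENNReal

variable {p : ℕ} [Fact p.Prime]

/-- The radius `p^(-1/(p-1))` of convergence of the `p`-adic exponential series. -/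
def expRadius (p : ℕ) : ℝ≥0 := (p : ℝ≥0) ^ (-(1 / ((p : ℝ) - 1)))

theorem coe_expRadius (p : ℕ) : (expRadius p : ℝ) = (p : ℝ) ^ (-(1 / ((p : ℝ) - 1))) := by
  rw [expRadius, NNReal.coe_rpow, NNReal.coe_natCast]

/-- Legendre's formula: `(p - 1) v(n!)` is `n` minus the digit sum of `n` in base `p`, hence at most
`n`. -/
theorem norm_inv_factorial_mul_le (n : ℕ) :
    ‖((n.factorial : ℚ_[p])⁻¹)‖ * (expRadius p : ℝ) ^ n ≤ 1 := by
  have hp : 1 < p := (Fact.out : p.Prime).one_lt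
  have hp1 : (1 : ℝ) < p := by exact_mod_cast hp
  have hp0 : (0 : ℝ) < p := by linarith
  have h0 : (n.factorial : ℚ_[p]) ≠ 0 := by exact_mod_cast n.factorial_ne_zero
  rw [norm_inv, Padic.norm_eq_zpow_neg_valuation h0, Padic.valuation_natCast, zpow_neg, inv_inv,
    zpow_natCast, coe_expRadius, ← Real.rpow_natCast, ← Real.rpow_natCast, ← Real.rpow_mul hp0.le,
    ← Real.rpow_add hp0]
  refine Real.rpow_le_one_of_one_le_of_nonpos hp1.le ?_
  have h1 : (p - 1) * padicValNat p n.factorial ≤ n := by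
    rw [sub_one_mul_padicValNat_factorial]
    exact Nat.sub_le _ _
  have h2 : ((p : ℝ) - 1) * padicValNat p n.factorial ≤ n := by
    have : (((p - 1) * padicValNat p n.factorial : ℕ) : ℝ) ≤ n := by exact_mod_cast h1
    rwa [Nat.cast_mul, Nat.cast_sub hp.le, Nat.cast_one] at this
  have h3 : (padicValNat p n.factorial : ℝ) ≤ n / ((p : ℝ) - 1) := by
    rw [le_div_iff₀ (by linarith), mul_comm]
    exact h2
  have h4 : -(1 / ((p : ℝ) - 1)) * n = -(n / ((p : ℝ) - 1)) := by ring
  rw [h4]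
  linarith

theorem expRadius_le_radius (A : Type*) [NormedRing A] [NormedAlgebra ℚ_[p] A] [NormOneClass A] :
    (expRadius p : ℝ≥0∞) ≤ (NormedSpace.expSeries ℚ_[p] A).radius := by
  refine FormalMultilinearSeries.le_radius_of_bound _ 1 fun n => ?_
  rw [NormedSpace.expSeries, norm_smul, ContinuousMultilinearMap.norm_mkPiAlgebraFin, mul_one]
  exact norm_inv_factorial_mul_le n

/-- For odd `p` this is `1 > 1/(p-1)`. For `p = 2` the multiplier `2` would lie exactly on the
boundary, while `4` has valuation `2 > 1`. -/
theorem norm_expMul_lt : ‖(expMul p : ℚ_[p])‖ < expRadius p := by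
  have hp : 2 ≤ p := (Fact.out : p.Prime).two_le
  have hp0 : (0 : ℝ) < p := by exact_mod_cast (by omega : 0 < p)
  have hp1 : (1 : ℝ) < p := by exact_mod_cast (by omega : 1 < p)
  rw [coe_expRadius, expMul]
  split_ifs with h
  · subst h
    have h4 : ((4 : ℕ) : ℚ_[2]) = ((2 : ℕ) : ℚ_[2]) ^ 2 := by norm_num
    rw [h4, norm_pow, Padic.norm_p]
    norm_num
  · rw [Padic.norm_p, ← Real.rpow_neg_one]
    refine Real.rpow_lt_rpow_of_exponent_lt hp1 (neg_lt_neg ?_)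
    have : (3 : ℝ) ≤ p := by exact_mod_cast (by omega : 3 ≤ p)
    rw [div_lt_one (by linarith)]
    linarith

theorem mem_eball_of_norm_le {A : Type*} [NormedRing A] [NormedAlgebra ℚ_[p] A] [NormOneClass A]
    {x : A} (hx : ‖x‖ ≤ ‖(expMul p : ℚ_[p])‖) :
    x ∈ Metric.eball (0 : A) (NormedSpace.expSeries ℚ_[p] A).radius := by
  rw [Metric.mem_eball, edist_zero_right]
  refine lt_of_lt_of_le ?_ (expRadius_le_radius A)
  rw [enorm_eq_nnnorm, ENNReal.coe_lt_coe]
  rw [← NNReal.coe_lt_coe, coe_nnnorm]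
  exact lt_of_le_of_lt hx norm_expMul_lt

theorem norm_smul_expMul_smul_le {A : Type*} [NormedRing A] [NormedAlgebra ℚ_[p] A] [NormOneClass A]
    {x : ℚ_[p]} (hx : ‖x‖ ≤ 1) {y : A} (hy : ‖y‖ ≤ 1) :
    ‖x • ((expMul p : ℚ_[p]) • y)‖ ≤ ‖(expMul p : ℚ_[p])‖ := by
  rw [norm_smul, norm_smul]
  calc ‖x‖ * (‖(expMul p : ℚ_[p])‖ * ‖y‖) ≤ 1 * (‖(expMul p : ℚ_[p])‖ * 1) := by gcongr
    _ = _ := by ring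

theorem isOpen_norm_le_one : IsOpen {x : ℚ_[p] | ‖x‖ ≤ 1} := by
  simpa [Metric.closedBall] using
    IsUltrametricDist.isOpen_closedBall (0 : ℚ_[p]) (one_ne_zero : (1 : ℝ) ≠ 0)

theorem hasStrictDerivAt_exp_smul {A : Type*} [NormedRing A] [NormedAlgebra ℚ_[p] A]
    [NormOneClass A] [CompleteSpace A] {y : A} (hy : ‖y‖ ≤ 1) {x : ℚ_[p]} (hx : ‖x‖ ≤ 1) :
    HasStrictDerivAt (fun u : ℚ_[p] => NormedSpace.exp (u • ((expMul p : ℚ_[p]) • y)))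
      (NormedSpace.exp (x • ((expMul p : ℚ_[p]) • y)) * ((expMul p : ℚ_[p]) • y)) x :=
  hasStrictDerivAt_exp_smul_const_of_mem_ball _ _
    (mem_eball_of_norm_le (norm_smul_expMul_smul_le hx hy))

theorem analyticAt_exp_smul {A : Type*} [NormedRing A] [NormedAlgebra ℚ_[p] A]
    [NormOneClass A] [CompleteSpace A] {y : A} (hy : ‖y‖ ≤ 1) {x : ℚ_[p]} (hx : ‖x‖ ≤ 1) :
    AnalyticAt ℚ_[p] (fun u : ℚ_[p] => NormedSpace.exp (u • ((expMul p : ℚ_[p]) • y))) x := by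
  have h1 : AnalyticAt ℚ_[p] (NormedSpace.exp : A → A) (x • ((expMul p : ℚ_[p]) • y)) :=
    NormedSpace.analyticAt_exp_of_mem_ball _ (mem_eball_of_norm_le (norm_smul_expMul_smul_le hx hy))
  have h2 : AnalyticAt ℚ_[p] (fun u : ℚ_[p] => u • ((expMul p : ℚ_[p]) • y)) x := by fun_prop
  exact AnalyticAt.comp (f := fun u : ℚ_[p] => u • ((expMul p : ℚ_[p]) • y)) h1 h2

theorem expQ_eq : expQ p = fun x : ℚ_[p] =>
    NormedSpace.exp (x • ((expMul p : ℚ_[p]) • (1 : ℚ_[p]))) := by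
  ext x
  simp [expQ, mul_comm]

theorem analyticAt_expQ {x : ℚ_[p]} (hx : ‖x‖ ≤ 1) : AnalyticAt ℚ_[p] (expQ p) x := by
  rw [expQ_eq]
  exact analyticAt_exp_smul norm_one.le hx

theorem hasDerivAt_expQ {x : ℚ_[p]} (hx : ‖x‖ ≤ 1) :
    HasDerivAt (expQ p) (expMul p * expQ p x) x := by
  have h := (hasStrictDerivAt_exp_smul (y := (1 : ℚ_[p])) norm_one.le hx).hasDerivAt
  rw [← expQ_eq] at h
  refine h.congr_deriv ?_
  simp [expQ, mul_comm]

theorem expC_algebraMap {x : ℚ_[p]} (hx : ‖x‖ ≤ 1) :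
    expC p (algebraMap ℚ_[p] ℂ_[p] x) = algebraMap ℚ_[p] ℂ_[p] (expQ p x) := by
  rw [expQ, NormedSpace.algebraMap_exp_comm_of_mem_ball, expC, map_mul, map_natCast]
  refine mem_eball_of_norm_le ?_
  rw [norm_mul]
  exact mul_le_of_le_one_right (norm_nonneg _) hx

/-- The coordinate functions of an exponential in a basis of a finite-dimensional extension. -/
theorem exists_coordinates {β : ℂ_[p]} (hβ : IsIntegral ℚ_[p] β) (hβ1 : ‖β‖ ≤ 1) (j : ℕ)
    (κ : Fin (deg β) → ℕ → ℚ_[p])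
    (hκ : ∀ k, β ^ k = ∑ i, algebraMap ℚ_[p] ℂ_[p] (κ i k) * β ^ (i : ℕ)) (i : Fin (deg β))
    {x : ℚ_[p]} (hx : ‖x‖ ≤ 1) :
    AnalyticAt ℚ_[p] (decomp β i j) x ∧
      HasDerivAt (decomp β i j) (expMul p * ∑ l : Fin (deg β), κ i (j + l) * decomp β l j x) x := by
  -- The exponential is taken inside this complete field, so that the `c_{i,j}` are continuous
  -- linear coordinates of it. Differentiation multiplies by `expMul p • b ^ j`, which acts on
  -- coordinates through `κ`.
  let B := ℚ_[p]⟮β⟯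
  have : FiniteDimensional ℚ_[p] B := IntermediateField.adjoin.finiteDimensional hβ
  have : CompleteSpace B := FiniteDimensional.complete ℚ_[p] B
  let b : B := IntermediateField.AdjoinSimple.gen ℚ_[p] β
  have hb : (b : ℂ_[p]) = β := IntermediateField.AdjoinSimple.coe_gen _ _
  let pb := IntermediateField.adjoin.powerBasis hβ
  let bas : Module.Basis (Fin (deg β)) ℚ_[p] B :=
    pb.basis.reindex (finCongr (by rw [deg_eq hβ]; rfl))
  have hbas : ∀ i, bas i = b ^ (i : ℕ) := by
    intro i
    simp [bas, pb, b]
  let coord : Fin (deg β) → B →L[ℚ_[p]] ℚ_[p] := fun i => (bas.coord i).toContinuousLinearMap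
  have hsum : ∀ y : B, (y : ℂ_[p]) = ∑ i, algebraMap ℚ_[p] ℂ_[p] (coord i y) * β ^ (i : ℕ) := by
    intro y
    have h := congrArg (algebraMap B ℂ_[p]) (bas.sum_repr y)
    rw [map_sum] at h
    refine h.symm.trans (Finset.sum_congr rfl fun i _ => ?_)
    rw [Algebra.smul_def, map_mul, hbas, map_pow]
    congr 1
  have hli : LinearIndependent ℚ_[p] fun i : Fin (deg β) => β ^ (i : ℕ) := by
    rw [deg_eq hβ]
    exact linearIndependent_pow β
  have hcoord : ∀ i k, coord i (b ^ k) = κ i k := by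
    intro i k
    have h1 := hsum (b ^ k)
    have h2 : ((b ^ k : B) : ℂ_[p]) = β ^ k := by rw [← hb]; rfl
    rw [h2, hκ k] at h1
    simp only [← Algebra.smul_def] at h1
    have h0 : ∑ i, (coord i (b ^ k) - κ i k) • β ^ (i : ℕ) = 0 := by
      simp only [sub_smul, Finset.sum_sub_distrib, h1, sub_self]
    exact sub_eq_zero.1 (Fintype.linearIndependent_iff.1 hli _ h0 i)
  have hbj : ‖b ^ j‖ ≤ 1 := by
    have h1 : ‖b ^ j‖ = ‖β‖ ^ j := by
      rw [← norm_pow, ← hb]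
      rfl
    rw [h1]
    exact pow_le_one₀ (norm_nonneg _) hβ1
  let ex : ℚ_[p] → B := fun u => NormedSpace.exp (u • ((expMul p : ℚ_[p]) • b ^ j))
  have hex : ∀ u : ℚ_[p], ‖u‖ ≤ 1 → ∀ i, coord i (ex u) = decomp β i j u := by
    intro u hu
    refine IsDecomposition.eq_decomp hβ ?_
    rw [IsDecomposition, ← hsum]
    have h1 := NormedSpace.map_exp_of_mem_ball (𝕂 := ℚ_[p]) (algebraMap B ℂ_[p])
      continuous_subtype_val _ (mem_eball_of_norm_le (norm_smul_expMul_smul_le hu hbj))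
    refine Eq.trans ?_ h1.symm
    rw [expC]
    congr 1
    simp only [Algebra.smul_def, map_mul, map_pow, map_natCast]
    have h2 : algebraMap B ℂ_[p] b = β := hb
    have h3 : algebraMap B ℂ_[p] (algebraMap ℚ_[p] B u) = algebraMap ℚ_[p] ℂ_[p] u := rfl
    rw [h2, h3]
    ring
  have hev : ∀ i, (fun u => coord i (ex u)) =ᶠ[𝓝 x] decomp β i j := by
    intro i
    filter_upwards [isOpen_norm_le_one.mem_nhds hx] with u hu
    exact hex u hu i
  constructor
  · refine AnalyticAt.congr ?_ (hev i)
    exact ((coord i).analyticAt _).comp (analyticAt_exp_smul hbj hx)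
  · refine HasDerivAt.congr_of_eventuallyEq ?_ (hev i).symm
    have h1 := (coord i).hasFDerivAt.comp_hasDerivAt x (hasStrictDerivAt_exp_smul hbj hx).hasDerivAt
    refine h1.congr_deriv ?_
    have h2 : NormedSpace.exp (x • ((expMul p : ℚ_[p]) • b ^ j)) =
        ∑ l, decomp β l j x • b ^ (l : ℕ) := by
      refine (bas.sum_repr (ex x)).symm.trans (Finset.sum_congr rfl fun l _ => ?_)
      rw [hbas, ← hex x hx]
      rfl
    rw [h2, mul_smul_comm, map_smul, smul_eq_mul, Finset.sum_mul, map_sum]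
    congr 1
    refine Finset.sum_congr rfl fun l _ => ?_
    rw [smul_mul_assoc, map_smul, ← pow_add, hcoord, smul_eq_mul, mul_comm, add_comm]

theorem isScalarTower_rat (p : ℕ) [Fact p.Prime] :
    @IsScalarTower ℚ ℚ_[p] ℂ_[p] Algebra.toSMul Algebra.toSMul Algebra.toSMul :=
  IsScalarTower.of_algebraMap_eq' (Subsingleton.elim _ _)

/-- The structure constants of `ℚ_p(β)` lie in a field generated by one algebraic number. -/
theorem exists_structureConstants {β : ℂ_[p]} (hβ : IsAlgebraic ℚ β) :
    ∃ (θ : ℚ_[p]) (κ : Fin (deg β) → ℕ → ℚ_[p]), IsAlgebraic ℚ θ ∧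
      (∀ i k, κ i k ∈ Algebra.adjoin ℚ {θ}) ∧
      ∀ k, β ^ k = ∑ i, algebraMap ℚ_[p] ℂ_[p] (κ i k) * β ^ (i : ℕ) := by
  have := isScalarTower_rat p
  have hint : IsIntegral ℚ β := hβ.isIntegral
  have hint' : IsIntegral ℚ_[p] β := hint.tower_top
  set m := minpoly ℚ_[p] β with hm
  have hmon : m.Monic := minpoly.monic hint'
  -- Over `ℚ_p`, `m` divides the minimal polynomial of `β` over `ℚ`, so its coefficients are
  -- algebraic and generate a number field inside `ℚ_p`.
  have hcoeff : ∀ i, IsIntegral ℚ (m.coeff i) :=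
    Polynomial.isIntegral_coeff_of_dvd _ _ (minpoly.monic hint) hmon
      (minpoly.dvd_map_of_isScalarTower ℚ ℚ_[p] β)
  let S : Set ℚ_[p] := (fun i => m.coeff i) '' (m.support : Set ℕ)
  have : Finite S := (m.support.finite_toSet.image _).to_subtype
  let E := IntermediateField.adjoin ℚ S
  have : FiniteDimensional ℚ E := IntermediateField.finiteDimensional_adjoin (by
    rintro _ ⟨i, _, rfl⟩
    exact hcoeff i)
  obtain ⟨θ, hθ⟩ := Field.exists_primitive_element ℚ E
  have hθalg : IsAlgebraic ℚ θ := Algebra.IsAlgebraic.isAlgebraic θ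
  have hmem : ∀ y : E, (y : ℚ_[p]) ∈ Algebra.adjoin ℚ {(θ : ℚ_[p])} := by
    intro y
    have h1 : y ∈ ℚ⟮θ⟯.toSubalgebra := by rw [hθ]; trivial
    rw [IntermediateField.adjoin_simple_toSubalgebra_of_isAlgebraic hθalg] at h1
    induction h1 using Algebra.adjoin_induction with
    | mem y hy =>
      rw [Set.mem_singleton_iff.1 hy]
      exact Algebra.self_mem_adjoin_singleton ℚ _
    | algebraMap c =>
      have h2 : ((algebraMap ℚ E c : E) : ℚ_[p]) = algebraMap ℚ ℚ_[p] c := by simp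
      rw [h2]
      exact Subalgebra.algebraMap_mem _ c
    | add y z _ _ hy hz => exact Subalgebra.add_mem _ hy hz
    | mul y z _ _ hy hz => exact Subalgebra.mul_mem _ hy hz
  have hlift : m ∈ Polynomial.lifts (algebraMap E ℚ_[p]) := by
    rw [Polynomial.lifts_iff_coeff_lifts]
    intro i
    by_cases hi : i ∈ m.support
    · exact ⟨⟨m.coeff i, IntermediateField.subset_adjoin _ _ ⟨i, hi, rfl⟩⟩, rfl⟩
    · exact ⟨0, by rw [map_zero, Polynomial.notMem_support_iff.1 hi]⟩
  obtain ⟨μ, hμm, hμd, hμmon⟩ := Polynomial.lifts_and_natDegree_eq_and_monic hlift hmon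
  have hdpos : 0 < m.natDegree := minpoly.natDegree_pos hint'
  -- The structure constants are the coefficients of these remainders, so they lie in `E`.
  let r : ℕ → Polynomial E := fun k => (Polynomial.X ^ k) %ₘ μ
  have hr : ∀ k, (r k).natDegree < deg β := by
    intro k
    rw [deg_eq hint', ← hm, ← hμd]
    exact Polynomial.natDegree_modByMonic_lt _ hμmon (fun h => by
      rw [h, Polynomial.natDegree_one] at hμd
      omega)
  refine ⟨θ, fun i k => ((r k).coeff i : E), ?_, fun i k => hmem _, fun k => ?_⟩
  · exact hθalg.algebraMap (A := ℚ_[p])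
  · have hroot : Polynomial.aeval β μ = 0 := by
      have := minpoly.aeval ℚ_[p] β
      rw [← hm, ← hμm, Polynomial.aeval_map_algebraMap] at this
      exact this
    have h1 : Polynomial.aeval β (r k) = β ^ k := by
      rw [Polynomial.aeval_modByMonic_eq_self_of_root hroot]
      simp
    rw [← h1, Polynomial.aeval_eq_sum_range' (hr k), Finset.sum_range]
    refine Finset.sum_congr rfl fun i _ => ?_
    rw [Algebra.smul_def]
    rfl

end PadicExp

/-! ### Transcendence degree and the use of Schanuel's conjecture. -/

namespace PadicExp

open AlgebraicIndependent

variable {p : ℕ} [Fact p.Prime]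

/-- Every family contains a subfamily that is a transcendence basis for it. -/
theorem exists_algebraicIndependent_subfamily {L ι : Type*} [Field L] [CharZero L] (w : ι → L) :
    ∃ s : Set ι, AlgebraicIndependent ℤ (fun i : s => w i) ∧
      ∀ i, IsAlgebraic (Algebra.adjoin ℤ (Set.range fun i : s => w i)) (w i) := by
  obtain ⟨I, hI⟩ := (matroid ℤ L).exists_isBasis (Set.range w) (by simp)
  have hsub : ∀ x : I, ∃ i, w i = x := fun x => hI.subset x.2
  -- `w` may repeat values; one index is chosen for each element of the basis.
  choose σ hσ using hsub
  have hrange : (Set.range fun i : Set.range σ => w i) = I := by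
    ext x
    constructor
    · rintro ⟨⟨_, y, rfl⟩, rfl⟩
      simp only [hσ]
      exact y.2
    · intro hx
      exact ⟨⟨σ ⟨x, hx⟩, _, rfl⟩, hσ _⟩
  have hinj : Function.Injective fun i : Set.range σ => w i := by
    rintro ⟨_, y, rfl⟩ ⟨_, z, rfl⟩ h
    simp only [hσ] at h
    rw [Subtype.ext h]
  have hind := matroid_indep_iff.1 hI.indep
  refine ⟨Set.range σ, ?_, fun i => ?_⟩
  · have hind' : AlgebraicIndepOn ℤ id (Set.range fun i : Set.range σ => w i) := by
      rw [hrange]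
      exact hind
    exact (algebraicIndependent_subtype_range hinj).1 hind'
  · rw [hrange]
    have := hI.subset_closure ⟨i, rfl⟩
    rw [matroid_closure_eq] at this
    exact this

theorem isAlgebraic_of_mem_adjoin_rat {A L : Type*} [CommRing A] [IsDomain A]
    [Field L] [CharZero L] [Algebra A L] (S : Set L) (hS : ∀ x ∈ S, IsAlgebraic A x) :
    ∀ x ∈ IntermediateField.adjoin ℚ S, IsAlgebraic A x := by
  intro x hx
  induction hx using IntermediateField.adjoin_induction with
  | mem x hx => exact hS x hx
  | algebraMap q =>
    have h1 : ∀ m : ℤ, IsAlgebraic A (m : L) := fun m => by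
      simpa using isAlgebraic_algebraMap (R := A) (A := L) (m : A)
    have h2 : (algebraMap ℚ L q) = (q.num : L) * ((q.den : ℤ) : L)⁻¹ := by
      rw [eq_ratCast, Rat.cast_def]
      simp [div_eq_mul_inv]
    rw [h2]
    exact (h1 _).mul (h1 _).inv
  | add x y _ _ hx hy => exact hx.add hy
  | inv x _ hx => exact hx.inv
  | mul x y _ _ hx hy => exact hx.mul hy

/-- Lower bound from a transcendence degree for the size of a set over which everything is
algebraic. -/
theorem natCast_le_encard_of_le_trdeg {L : Type*} [Field L] [CharZero L] (S J : Set L) {N : ℕ}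
    (hN : (N : Cardinal) ≤ Algebra.trdeg ℚ (IntermediateField.adjoin ℚ S))
    (hS : ∀ x ∈ S, IsAlgebraic (Algebra.adjoin ℤ J) x) : (N : ℕ∞) ≤ J.encard := by
  obtain ⟨u, hu⟩ := exists_isTranscendenceBasis ℚ (IntermediateField.adjoin ℚ S)
  rw [← hu.cardinalMk_eq_trdeg] at hN
  let v : Set L := Subtype.val '' u
  have hv : AlgebraicIndepOn ℤ id v := by
    have h1 : AlgebraicIndependent ℤ
        ((↑) : u → IntermediateField.adjoin ℚ S) := hu.1.restrictScalars (by exact Int.cast_injective)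
    have h2 := h1.map' (f := ((IntermediateField.adjoin ℚ S).val.restrictScalars ℤ))
      Subtype.val_injective
    have h3 := h2.to_subtype_range
    have h4 : (Set.range (((IntermediateField.adjoin ℚ S).val.restrictScalars ℤ) ∘
        ((↑) : u → IntermediateField.adjoin ℚ S))) = v := by
      rw [Set.range_comp, Subtype.range_coe]
      rfl
    rw [h4] at h3
    exact h3
  -- In the matroid of algebraic independence, `v` is independent and lies in the closure of `J`, so
  -- comparing ranks gives the bound.
  have hvJ : v ⊆ (matroid ℤ L).closure J := by
    rw [matroid_closure_eq]
    rintro _ ⟨x, _, rfl⟩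
    exact isAlgebraic_of_mem_adjoin_rat S hS x x.2
  have h1 : v.encard ≤ J.encard := by
    rw [← (matroid_indep_iff.2 hv).eRk_eq_encard]
    calc (matroid ℤ L).eRk v ≤ (matroid ℤ L).eRk ((matroid ℤ L).closure J) :=
          (matroid ℤ L).eRk_mono hvJ
      _ = (matroid ℤ L).eRk J := Matroid.eRk_closure_eq _ _
      _ ≤ J.encard := Matroid.eRk_le_encard _ _
  refine le_trans ?_ h1
  have h2 : v.encard = u.encard := Subtype.val_injective.encard_image u
  rw [h2, Set.encard, ENat.card]
  simpa using Cardinal.toENat.monotone' hN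

/-- Under Schanuel's conjecture, linearly independent points give many algebraically independent
values. -/
theorem le_encard_of_schanuel (hS : SchanuelConjecture p) {β : ℂ_[p]} (hβ : IsAlgebraic ℚ β)
    (hβ1 : ‖β‖ ≤ 1) {n : ℕ} (hn : 1 ≤ n) (a : Fin n → ℚ_[p]) (ha : ∀ k, ‖a k‖ ≤ 1)
    (hli : LinearIndependent ℚ a) (J : Set ℂ_[p])
    (hJ : ∀ i : Indet n (deg β),
      IsAlgebraic (@Algebra.adjoin ℤ ℂ_[p] _ _ (Ring.toIntAlgebra _) J)
        (algebraMap ℚ_[p] ℂ_[p] (indetValue β a i))) :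
    ((n * deg β : ℕ) : ℕ∞) ≤ J.encard := by
  have htower := isScalarTower_rat p
  have hint : IsIntegral ℚ_[p] β := hβ.isIntegral.tower_top
  have hd : 0 < deg β := by
    rw [deg_eq hint]
    exact minpoly.natDegree_pos hint
  -- Independence over `ℚ` combines that of the `a k` over `ℚ` with that of the powers of `β` over
  -- `ℚ_p`.
  let t : Fin n × Fin (deg β) → ℂ_[p] := fun q =>
    (expMul p : ℂ_[p]) * (algebraMap ℚ_[p] ℂ_[p] (a q.1) * β ^ (q.2 : ℕ))
  have hmul : expMul p ≠ 0 := by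
    have : p ≠ 0 := (Fact.out : p.Prime).ne_zero
    rw [expMul]
    split_ifs <;> omega
  have ht : LinearIndependent ℚ t := by
    have hpow : LinearIndependent ℚ_[p] fun i : Fin (deg β) => β ^ (i : ℕ) := by
      rw [deg_eq hint]
      exact linearIndependent_pow β
    have h1 := linearIndependent_smul hli hpow
    have h2 := h1.map' (LinearMap.mulLeft ℚ (expMul p : ℂ_[p]))
      (LinearMap.ker_eq_bot.2 (mul_right_injective₀ (by exact_mod_cast hmul)))
    have h3 : t = LinearMap.mulLeft ℚ (expMul p : ℂ_[p]) ∘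
        fun q : Fin n × Fin (deg β) => a q.1 • β ^ (q.2 : ℕ) := by
      ext q
      simp [t, Algebra.smul_def]
    rw [h3]
    exact h2
  have hnorm : ∀ q, ‖t q‖ < (p : ℝ) ^ (-(1 / ((p : ℝ) - 1))) := by
    intro q
    rw [← coe_expRadius]
    refine lt_of_le_of_lt ?_ (norm_expMul_lt (p := p))
    have h1 : t q = a q.1 • ((expMul p : ℚ_[p]) • β ^ (q.2 : ℕ)) := by
      simp only [t, Algebra.smul_def, map_natCast]
      ring
    rw [h1]
    refine norm_smul_expMul_smul_le (ha _) ?_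
    rw [norm_pow]
    exact pow_le_one₀ (norm_nonneg _) hβ1
  let e : Fin (n * deg β) ≃ Fin n × Fin (deg β) := finProdFinEquiv.symm
  have hSch := hS (n * deg β) (t ∘ e) (Nat.mul_pos hn hd) (fun i => hnorm _)
    (ht.comp e e.injective)
  refine natCast_le_encard_of_le_trdeg _ J hSch ?_
  let A := @Algebra.adjoin ℤ ℂ_[p] _ _ (Ring.toIntAlgebra _) J
  have hβA : IsAlgebraic A β := by
    have h1 : IsAlgebraic ℤ β := (IsFractionRing.isAlgebraic_iff ℤ ℚ ℂ_[p]).2 hβ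
    exact h1.extendScalars (FaithfulSMul.algebraMap_injective ℤ A)
  rintro x (⟨i, rfl⟩ | ⟨i, rfl⟩)
  · have h1 : IsAlgebraic A (expMul p : ℂ_[p]) := isAlgebraic_natCast _
    exact h1.mul ((hJ (.X (e i).1)).mul (hβA.pow _))
  · have hexp : NormedSpace.exp ((t ∘ e) i) =
      expC p (algebraMap ℚ_[p] ℂ_[p] (a (e i).1) * β ^ ((e i).2 : ℕ)) := rfl
    simp only [hexp]
    obtain ⟨k, ⟨j, hj⟩⟩ := e i
    -- The exponent `0` gives `E_p(a_k)`, the block `E`; the exponents from `1` to `d - 1` are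
    -- expanded by the decomposition functions.
    cases j with
    | zero =>
      simp only [pow_zero, mul_one]
      rw [expC_algebraMap (ha k)]
      exact hJ (.E k)
    | succ j =>
      have h1 : expC p (algebraMap ℚ_[p] ℂ_[p] (a k) * β ^ (j + 1)) = _ :=
        isDecomposition_decomp hint (j + 1) (a k)
      simp only [h1]
      refine Finset.sum_induction _ (IsAlgebraic A) (fun _ _ => IsAlgebraic.add) isAlgebraic_zero
        fun l _ => ?_
      exact (hJ (.C l ⟨j, by omega⟩ k)).mul (hβA.pow _)

end PadicExp

/-! ### The differential ring generated by the decomposition functions. -/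

namespace PadicExp

open Filter Topology

variable {p : ℕ} [Fact p.Prime]

/-- The relations between finitely many elements of a field are locally generated by as many
relations as there are elements outside a transcendence basis. -/
theorem exists_subfamily_local_generators {L : Type*} [Field L] [CharZero L] {ι : Type} [Finite ι]
    (w : ι → L) :
    ∃ (s : Set ι) (r : (sᶜ : Set ι) → MvPolynomial ι ℤ),
      (∀ i, IsAlgebraic (@Algebra.adjoin ℤ L _ _ (Ring.toIntAlgebra L) (w '' s)) (w i)) ∧
      IsLocalKer (MvPolynomial.eval₂Hom (Int.castRingHom L) w) (Ideal.span (Set.range r)) := by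
  obtain ⟨s, hs, halg⟩ := exists_algebraicIndependent_subfamily w
  obtain ⟨r, hr⟩ := exists_local_generators_compl w s hs halg
  refine ⟨s, r, fun i => ?_, hr⟩
  have : w '' s = Set.range fun i : s => w i := Set.image_eq_range w s
  rw [this]
  exact halg i

/-- Schanuel speaks about `ℂ_p`, while the relations concern values in `ℚ_p`; this passes from one
to the other. -/
theorem IsLocalKer.of_comp_injective {A L L' : Type*} [CommRing A] [CommRing L] [CommRing L']
    {φ : A →+* L} {φ' : A →+* L'} {j : L →+* L'} (hj : Function.Injective j) {I : Ideal A}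
    (h : ∀ x, φ' x = j (φ x)) (hI : IsLocalKer φ' I) : IsLocalKer φ I := by
  have h0 : ∀ x, φ' x = 0 ↔ φ x = 0 := fun x => by rw [h, map_eq_zero_iff j hj]
  refine ⟨fun f hf => (h0 f).1 (hI.1 f hf), fun f hf => ?_⟩
  obtain ⟨g, hg, hgI⟩ := hI.2 f ((h0 f).2 hf)
  exact ⟨g, fun hg0 => hg ((h0 g).2 hg0), hgI⟩

section Grad

variable {K : Type*} [NontriviallyNormedField K] {n : ℕ} {f g : (Fin n → K) → K} {x : Fin n → K}

theorem grad_add (hf : DifferentiableAt K f x) (hg : DifferentiableAt K g x) :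
    grad (f + g) x = grad f x + grad g x := by
  ext l
  simp [grad, fderiv_add hf hg]

theorem grad_mul (hf : DifferentiableAt K f x) (hg : DifferentiableAt K g x) :
    grad (f * g) x = f x • grad g x + g x • grad f x := by
  ext l
  simp [grad, fderiv_mul hf hg]

theorem grad_const (c : K) : grad (fun _ : Fin n → K => c) x = 0 := by
  ext l
  simp [grad]

theorem grad_sum {ι : Type*} (u : Finset ι) {h : ι → (Fin n → K) → K}
    (hh : ∀ i ∈ u, DifferentiableAt K (h i) x) :
    grad (∑ i ∈ u, h i) x = ∑ i ∈ u, grad (h i) x := by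
  ext l
  simp [grad, fderiv_sum hh]

theorem grad_comp_apply {h : K → K} {k : Fin n} {h' : K} (hh : HasDerivAt h h' (x k)) (l : Fin n) :
    grad (fun x : Fin n → K => h (x k)) x l = if l = k then h' else 0 := by
  have h1 : HasFDerivAt (fun x : Fin n → K => x k) (ContinuousLinearMap.proj k) x :=
    (ContinuousLinearMap.proj (R := K) (φ := fun _ : Fin n => K) k).hasFDerivAt
  have h2 := hh.comp_hasFDerivAt x h1
  have h3 : grad (fun x : Fin n → K => h (x k)) x l =
      (h' • (ContinuousLinearMap.proj k : (Fin n → K) →L[K] K)) (Pi.single l 1) := by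
    rw [grad, ← h2.fderiv]
    rfl
  rw [h3]
  by_cases hl : l = k
  · subst hl
    simp
  · simp [hl, Ne.symm hl]

end Grad

/-- The functions that are polynomials in the coordinates, their exponentials, the decomposition
functions and a constant `θ`. -/
def functionAlgebra (β : ℂ_[p]) (n : ℕ) (θ : ℚ_[p]) :
    Subalgebra ℚ ((Fin n → ℚ_[p]) → ℚ_[p]) :=
  Algebra.adjoin ℚ (insert (fun _ => θ) (Set.range fun i x => indetValue β x i))

section FunctionAlgebra

variable {β : ℂ_[p]} {n : ℕ} {θ : ℚ_[p]}

theorem indetValue_mem (i : Indet n (deg β)) :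
    (fun x => indetValue β x i) ∈ functionAlgebra β n θ :=
  Algebra.subset_adjoin (Set.mem_insert_of_mem _ ⟨i, rfl⟩)

theorem const_mem {c : ℚ_[p]} (hc : c ∈ Algebra.adjoin ℚ {θ}) :
    (fun _ => c) ∈ functionAlgebra β n θ := by
  induction hc using Algebra.adjoin_induction with
  | mem y hy =>
    rw [Set.mem_singleton_iff.1 hy]
    exact Algebra.subset_adjoin (Set.mem_insert _ _)
  | algebraMap r => exact (functionAlgebra β n θ).algebraMap_mem r
  | add y z _ _ hy hz => exact Subalgebra.add_mem _ hy hz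
  | mul y z _ _ hy hz => exact Subalgebra.mul_mem _ hy hz

theorem F_mem (q : MvPolynomial (Indet n (deg β)) ℤ) : F β q ∈ functionAlgebra β n θ := by
  induction q using MvPolynomial.induction_on with
  | C m =>
    have : F β (MvPolynomial.C m : MvPolynomial (Indet n (deg β)) ℤ) = algebraMap ℚ _ (m : ℚ) := by
      ext x
      simp [F]
    rw [this]
    exact Subalgebra.algebraMap_mem _ _
  | add q r hq hr =>
    have : F β (q + r) = F β q + F β r := by
      ext x
      simp [F]
    rw [this]
    exact Subalgebra.add_mem _ hq hr
  | mul_X q i hq =>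
    have : F β (q * MvPolynomial.X i) = F β q * fun x => indetValue β x i := by
      ext x
      simp [F]
    rw [this]
    exact Subalgebra.mul_mem _ hq (indetValue_mem i)

/-- Evaluation of polynomials with one additional variable at the point `x` and at `θ`. -/
def evalAt (β : ℂ_[p]) {n : ℕ} (θ : ℚ_[p]) (x : Fin n → ℚ_[p]) :
    Polynomial (MvPolynomial (Indet n (deg β)) ℤ) →+* ℚ_[p] :=
  Polynomial.eval₂RingHom (MvPolynomial.aeval (indetValue β x)).toRingHom θ

theorem evalAt_C (x : Fin n → ℚ_[p]) (q : MvPolynomial (Indet n (deg β)) ℤ) :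
    evalAt β θ x (Polynomial.C q) = F β q x := by
  simp [evalAt, F]

theorem evalAt_eq_sum (G : Polynomial (MvPolynomial (Indet n (deg β)) ℤ)) :
    (fun x => evalAt β θ x G) = ∑ i ∈ G.support, (fun _ => θ ^ i) * F β (G.coeff i) := by
  ext x
  rw [evalAt, Polynomial.coe_eval₂RingHom, Polynomial.eval₂_eq_sum, Polynomial.sum,
    Finset.sum_apply]
  exact Finset.sum_congr rfl fun i _ => mul_comm _ _

theorem evalAt_mem (G : Polynomial (MvPolynomial (Indet n (deg β)) ℤ)) :
    (fun x => evalAt β θ x G) ∈ functionAlgebra β n θ := by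
  rw [evalAt_eq_sum]
  exact Subalgebra.sum_mem _ fun i _ => Subalgebra.mul_mem _
    (const_mem (pow_mem (Algebra.self_mem_adjoin_singleton ℚ θ) i)) (F_mem _)

/-- Rational denominators are cleared by `N`, and the constant `θ` becomes the additional variable.
-/
theorem exists_evalAt_eq {f : (Fin n → ℚ_[p]) → ℚ_[p]} (hf : f ∈ functionAlgebra β n θ) :
    ∃ (N : ℤ) (G : Polynomial (MvPolynomial (Indet n (deg β)) ℤ)), N ≠ 0 ∧
      ∀ x, (N : ℚ_[p]) * f x = evalAt β θ x G := by
  induction hf using Algebra.adjoin_induction with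
  | mem f hf =>
    rcases hf with rfl | ⟨i, rfl⟩
    · exact ⟨1, Polynomial.X, one_ne_zero, fun x => by simp [evalAt]⟩
    · exact ⟨1, Polynomial.C (MvPolynomial.X i), one_ne_zero, fun x => by simp [evalAt]⟩
  | algebraMap r =>
    refine ⟨r.den, Polynomial.C (MvPolynomial.C r.num), by exact_mod_cast r.den_ne_zero,
      fun x => ?_⟩
    have h1 : (algebraMap ℚ ((Fin n → ℚ_[p]) → ℚ_[p]) r) x = (r : ℚ_[p]) := rfl
    rw [h1]
    simp only [evalAt, Polynomial.coe_eval₂RingHom, Polynomial.eval₂_C]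
    have h2 : ((r.den : ℤ) : ℚ_[p]) * (r : ℚ_[p]) = (r.num : ℚ_[p]) := by
      exact_mod_cast congrArg (fun r : ℚ => (r : ℚ_[p])) (Rat.den_mul_eq_num r)
    rw [h2]
    simp
  | add f g _ _ hf hg =>
    obtain ⟨N, G, hN, hG⟩ := hf
    obtain ⟨M, H, hM, hH⟩ := hg
    refine ⟨N * M, Polynomial.C (MvPolynomial.C M) * G + Polynomial.C (MvPolynomial.C N) * H,
      mul_ne_zero hN hM, fun x => ?_⟩
    rw [map_add, map_mul, map_mul, ← hG, ← hH, evalAt_C, evalAt_C]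
    simp [F]
    ring
  | mul f g _ _ hf hg =>
    obtain ⟨N, G, hN, hG⟩ := hf
    obtain ⟨M, H, hM, hH⟩ := hg
    refine ⟨N * M, G * H, mul_ne_zero hN hM, fun x => ?_⟩
    rw [map_mul, ← hG, ← hH]
    simp
    ring

/-- The unit polydisc. -/
def polydisc (p : ℕ) [Fact p.Prime] (n : ℕ) : Set (Fin n → ℚ_[p]) := {x | ∀ k, ‖x k‖ ≤ 1}

theorem isOpen_polydisc : IsOpen (polydisc p n) := by
  have : polydisc p n = ⋂ k, (fun x : Fin n → ℚ_[p] => x k) ⁻¹' {y | ‖y‖ ≤ 1} := by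
    ext x
    simp [polydisc]
  rw [this]
  exact isOpen_iInter_of_finite fun k => isOpen_norm_le_one.preimage (continuous_apply k)

/-- Structure constants of `ℚ_p(β)` in the basis of powers of `β`, inside `ℚ[θ]`. -/
def IsStructureConstants (β : ℂ_[p]) (θ : ℚ_[p]) (κ : Fin (deg β) → ℕ → ℚ_[p]) : Prop :=
  (∀ i k, κ i k ∈ Algebra.adjoin ℚ {θ}) ∧
    ∀ k, β ^ k = ∑ i, algebraMap ℚ_[p] ℂ_[p] (κ i k) * β ^ (i : ℕ)

theorem analyticAt_indetValue {κ : Fin (deg β) → ℕ → ℚ_[p]} (hβ : IsIntegral ℚ_[p] β)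
    (hβ1 : ‖β‖ ≤ 1) (hκ : IsStructureConstants β θ κ) (i : Indet n (deg β))
    {x : Fin n → ℚ_[p]} (hx : x ∈ polydisc p n) :
    AnalyticAt ℚ_[p] (fun x => indetValue β x i) x := by
  have hproj : ∀ k, AnalyticAt ℚ_[p] (fun x : Fin n → ℚ_[p] => x k) x := fun k =>
    (ContinuousLinearMap.proj (R := ℚ_[p]) (φ := fun _ : Fin n => ℚ_[p]) k).analyticAt x
  cases i with
  | X k => exact hproj k
  | E k => exact AnalyticAt.comp (f := fun x : Fin n → ℚ_[p] => x k) (analyticAt_expQ (hx k)) (hproj k)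
  | C i j k =>
    exact AnalyticAt.comp (f := fun x : Fin n → ℚ_[p] => x k)
      (exists_coordinates hβ hβ1 _ κ hκ.2 i (hx k)).1 (hproj k)

theorem analyticAt_of_mem {κ : Fin (deg β) → ℕ → ℚ_[p]} (hβ : IsIntegral ℚ_[p] β)
    (hβ1 : ‖β‖ ≤ 1) (hκ : IsStructureConstants β θ κ) {f : (Fin n → ℚ_[p]) → ℚ_[p]}
    (hf : f ∈ functionAlgebra β n θ) {x : Fin n → ℚ_[p]} (hx : x ∈ polydisc p n) :
    AnalyticAt ℚ_[p] f x := by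
  induction hf using Algebra.adjoin_induction with
  | mem f hf =>
    rcases hf with rfl | ⟨i, rfl⟩
    · exact analyticAt_const
    · exact analyticAt_indetValue hβ hβ1 hκ i hx
  | algebraMap r => exact analyticAt_const (v := (r : ℚ_[p]))
  | add f g _ _ hf hg => exact hf.add hg
  | mul f g _ _ hf hg => exact hf.mul hg

/-- Each generator depends on one coordinate. For fixed `j` the `c_{l,j}` satisfy a linear
differential system with coefficients in `ℚ[θ]`, which is why `θ` was adjoined. -/
theorem exists_partialDeriv_indetValue {κ : Fin (deg β) → ℕ → ℚ_[p]} (hβ : IsIntegral ℚ_[p] β)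
    (hβ1 : ‖β‖ ≤ 1) (hκ : IsStructureConstants β θ κ) (i : Indet n (deg β)) (l : Fin n) :
    ∃ f' ∈ functionAlgebra β n θ, ∀ x ∈ polydisc p n,
      f' x = grad (fun x => indetValue β x i) x l := by
  have key : ∀ (h : ℚ_[p] → ℚ_[p]) (k : Fin n) (h' : (Fin n → ℚ_[p]) → ℚ_[p]),
      h' ∈ functionAlgebra β n θ → (∀ x ∈ polydisc p n, HasDerivAt h (h' x) (x k)) →
      ∃ f' ∈ functionAlgebra β n θ, ∀ x ∈ polydisc p n, f' x = grad (fun x => h (x k)) x l := by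
    intro h k h' hh' hd
    by_cases hl : l = k
    · exact ⟨h', hh', fun x hx => by rw [grad_comp_apply (hd x hx), if_pos hl]⟩
    · exact ⟨0, zero_mem _, fun x hx => by rw [grad_comp_apply (hd x hx), if_neg hl]; rfl⟩
  cases i with
  | X k => exact key id k 1 (one_mem _) fun x _ => hasDerivAt_id _
  | E k =>
    exact key (expQ p) k ((expMul p : (Fin n → ℚ_[p]) → ℚ_[p]) * fun x => indetValue β x (.E k))
      (mul_mem (natCast_mem _ _) (indetValue_mem _)) fun x hx => hasDerivAt_expQ (hx k)
  | C i j k =>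
    refine key (decomp β i (j + 1)) k ((expMul p : (Fin n → ℚ_[p]) → ℚ_[p]) *
      ∑ l : Fin (deg β), (fun _ => κ i (j + 1 + l)) * fun x => indetValue β x (.C l j k))
      (mul_mem (natCast_mem _ _) (sum_mem fun l _ =>
        mul_mem (const_mem (hκ.1 _ _)) (indetValue_mem _))) fun x hx => ?_
    convert (exists_coordinates hβ hβ1 (j + 1) κ hκ.2 i (hx k)).2 using 1
    simp [indetValue]

theorem exists_partialDeriv {κ : Fin (deg β) → ℕ → ℚ_[p]} (hβ : IsIntegral ℚ_[p] β)
    (hβ1 : ‖β‖ ≤ 1) (hκ : IsStructureConstants β θ κ) {f : (Fin n → ℚ_[p]) → ℚ_[p]}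
    (hf : f ∈ functionAlgebra β n θ) (l : Fin n) :
    ∃ f' ∈ functionAlgebra β n θ, ∀ x ∈ polydisc p n, f' x = grad f x l := by
  induction hf using Algebra.adjoin_induction with
  | mem f hf =>
    rcases hf with rfl | ⟨i, rfl⟩
    · exact ⟨0, zero_mem _, fun x _ => by rw [grad_const]; rfl⟩
    · exact exists_partialDeriv_indetValue hβ hβ1 hκ i l
  | algebraMap r =>
    refine ⟨0, zero_mem _, fun x _ => ?_⟩
    have : algebraMap ℚ ((Fin n → ℚ_[p]) → ℚ_[p]) r = fun _ => (r : ℚ_[p]) := rfl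
    rw [this, grad_const]
    rfl
  | add f g hf𝓑 hg𝓑 hf hg =>
    obtain ⟨f', hf', hff'⟩ := hf
    obtain ⟨g', hg', hgg'⟩ := hg
    refine ⟨f' + g', add_mem hf' hg', fun x hx => ?_⟩
    rw [grad_add (analyticAt_of_mem hβ hβ1 hκ hf𝓑 hx).differentiableAt
      (analyticAt_of_mem hβ hβ1 hκ hg𝓑 hx).differentiableAt, Pi.add_apply, Pi.add_apply,
      hff' x hx, hgg' x hx]
  | mul f g hf𝓑 hg𝓑 hf hg =>
    obtain ⟨f', hf', hff'⟩ := hf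
    obtain ⟨g', hg', hgg'⟩ := hg
    refine ⟨f * g' + g * f', add_mem (mul_mem hf𝓑 hg') (mul_mem hg𝓑 hf'), fun x hx => ?_⟩
    rw [grad_mul (analyticAt_of_mem hβ hβ1 hκ hf𝓑 hx).differentiableAt
      (analyticAt_of_mem hβ hβ1 hκ hg𝓑 hx).differentiableAt]
    simp [hff' x hx, hgg' x hx]

/-- The gradients of functions with coefficients in `ℚ(θ)` are combinations of gradients of
functions with integral coefficients. -/
theorem grad_mem_span {κ : Fin (deg β) → ℕ → ℚ_[p]} (hβ : IsIntegral ℚ_[p] β)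
    (hβ1 : ‖β‖ ≤ 1) (hκ : IsStructureConstants β θ κ) (hθ : IsAlgebraic ℚ θ)
    {f : (Fin n → ℚ_[p]) → ℚ_[p]} (hf : f ∈ functionAlgebra β n θ) {a : Fin n → ℚ_[p]}
    (ha : a ∈ polydisc p n) (hfa : f a = 0) :
    grad f a ∈ Submodule.span ℚ_[p]
      ((fun q => grad (F β q) a) '' {q : MvPolynomial (Indet n (deg β)) ℤ | F β q a = 0}) := by
  have hdiff : ∀ g ∈ functionAlgebra β n θ, DifferentiableAt ℚ_[p] g a := fun g hg =>
    (analyticAt_of_mem hβ hβ1 hκ hg ha).differentiableAt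
  obtain ⟨N, G, hN, hG⟩ := exists_evalAt_eq hf
  obtain ⟨b, hbM, hb⟩ := IsLocalization.integerNormalization_spec (nonZeroDivisors ℤ)
    (minpoly ℚ θ)
  set μ₀ := IsLocalization.integerNormalization (nonZeroDivisors ℤ) (minpoly ℚ θ) with hμ₀
  -- An integral multiple of the minimal polynomial of `θ`, in the additional variable. It evaluates
  -- to zero at every `x`, not only at `a`, and its derivative does not, by separability.
  let μ : Polynomial (MvPolynomial (Indet n (deg β)) ℤ) := μ₀.map MvPolynomial.C
  have hμeval : ∀ (ν : Polynomial ℤ) (x : Fin n → ℚ_[p]),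
      evalAt β θ x (ν.map MvPolynomial.C) = Polynomial.aeval θ (ν.map (algebraMap ℤ ℚ)) := by
    intro ν x
    rw [evalAt, Polynomial.coe_eval₂RingHom, Polynomial.eval₂_map, Polynomial.aeval_def,
      Polynomial.eval₂_map]
    congr 1
    exact RingHom.ext_int _ _
  have hμ : ∀ x, evalAt β θ x μ = 0 := by
    intro x
    rw [hμeval, hb]
    simp
  have hb0 : b ≠ 0 := nonZeroDivisors.ne_zero hbM
  have hμ' : evalAt β θ a (Polynomial.derivative μ) ≠ 0 := by
    rw [Polynomial.derivative_map, hμeval, ← Polynomial.derivative_map, hb]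
    have hsep : (minpoly ℚ θ).Separable := (minpoly.irreducible hθ.isIntegral).separable
    have h1 := hsep.aeval_derivative_ne_zero (minpoly.aeval ℚ θ)
    have h2 : (b : ℚ_[p]) ≠ 0 := by exact_mod_cast hb0
    have h3 : (b • minpoly ℚ θ : Polynomial ℚ) = Polynomial.C (b : ℚ) * minpoly ℚ θ := by simp
    rw [h3, Polynomial.derivative_C_mul, map_mul, Polynomial.aeval_C]
    refine mul_ne_zero ?_ h1
    simpa using h2
  let φ := (evalAt β θ a).comp Polynomial.C
  have hφ : ∀ q, φ q = F β q a := fun q => evalAt_C a q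
  have hker : IsLocalKer φ (RingHom.ker φ) :=
    ⟨fun f hf => hf, fun f hf => ⟨1, by simp, by simpa using hf⟩⟩
  obtain ⟨H, hH, hHG⟩ := exists_multiplier_mem_map_sup (evalAt β θ a) hker μ (hμ a) hμ' G
    (by rw [← hG, hfa, mul_zero])
  obtain ⟨q, hq, q', hq', hqq⟩ := Submodule.mem_sup.1 hHG
  obtain ⟨c, rfl⟩ := Ideal.mem_span_singleton'.1 hq'
  rw [Ideal.mem_map_C_iff] at hq
  -- The `μ` term vanishes at every `x`, so this is an identity of functions and may be
  -- differentiated. At `a`, where `f` and the coefficients of `q` vanish, it writes a nonzero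
  -- multiple of the gradient of `f` through gradients of integral relations.
  have hfun : ((fun x => evalAt β θ x H) * fun x => evalAt β θ x G) =
      ∑ i ∈ q.support, (fun _ => θ ^ i) * F β (q.coeff i) := by
    rw [← evalAt_eq_sum]
    ext x
    have := congrArg (evalAt β θ x) hqq
    rw [map_add, map_mul, map_mul, hμ, mul_zero, add_zero] at this
    exact this.symm
  have hfG : (fun x => evalAt β θ x G) = (fun _ => (N : ℚ_[p])) * f := by
    ext x
    exact (hG x).symm
  have hgrad : grad _ a = grad _ a := congrArg (fun f => grad f a) hfun
  have hconst : ∀ c : ℚ_[p], DifferentiableAt ℚ_[p] (fun _ : Fin n → ℚ_[p] => c) a :=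
    fun c => differentiableAt_const c
  rw [grad_mul (hdiff _ (evalAt_mem H)) (hdiff _ (evalAt_mem G)), ← hG a, hfa, mul_zero, zero_smul,
    add_zero, hfG, grad_mul (hconst _) (hdiff f hf), grad_const, smul_zero, add_zero,
    grad_sum _ (fun i _ => (hconst _).mul (hdiff _ (F_mem _))), smul_smul] at hgrad
  have hne : evalAt β θ a H * (N : ℚ_[p]) ≠ 0 := mul_ne_zero hH (by exact_mod_cast hN)
  rw [← Submodule.smul_mem_iff _ hne, hgrad]
  refine Submodule.sum_mem _ fun i _ => ?_
  rw [grad_mul (hconst _) (hdiff _ (F_mem _)), grad_const, smul_zero, add_zero]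
  refine Submodule.smul_mem _ _ (Submodule.subset_span ⟨q.coeff i, ?_, rfl⟩)
  have := hq i
  rwa [RingHom.mem_ker, hφ] at this

end FunctionAlgebra

end PadicExp

/-! ### Maximal relation ideals, spanning gradients and the count of generators. -/

namespace PadicExp

open Filter Topology

variable {p : ℕ} [Fact p.Prime]

/-- The indeterminates as a sum of finite types. -/
def Indet.equiv (n d : ℕ) : Indet n d ≃ (Fin n ⊕ Fin n) ⊕ (Fin d × Fin (d - 1) × Fin n) where
  toFun
    | .X k => .inl (.inl k)
    | .E k => .inl (.inr k)
    | .C i j k => .inr (i, j, k)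
  invFun
    | .inl (.inl k) => .X k
    | .inl (.inr k) => .E k
    | .inr (i, j, k) => .C i j k
  left_inv x := by cases x <;> rfl
  right_inv x := by rcases x with (x | x) | x <;> rfl

instance (n d : ℕ) : Finite (Indet n d) := Finite.of_equiv _ (Indet.equiv n d).symm

theorem Indet.card (n d : ℕ) : Nat.card (Indet n d) = n + n + d * ((d - 1) * n) := by
  rw [Nat.card_congr (Indet.equiv n d)]
  simp

/-- The evaluation of polynomials at the values of the indeterminates. -/
def evalHom (β : ℂ_[p]) {n : ℕ} (x : Fin n → ℚ_[p]) :
    MvPolynomial (Indet n (deg β)) ℤ →+* ℚ_[p] :=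
  (MvPolynomial.aeval (indetValue β x)).toRingHom

theorem exists_incl_eq {n : ℕ} {x : Fin n → ℚ_[p]} (hx : x ∈ polydisc p n) :
    ∃ a : Fin n → ℤ_[p], incl a = x :=
  ⟨fun k => ⟨x k, hx k⟩, rfl⟩

theorem incl_mem {n : ℕ} (a : Fin n → ℤ_[p]) : incl a ∈ polydisc p n := fun k => (a k).2

/-- At a point where the ideal of relations is maximal among those of the zeros of `P`, the
gradients of the relations span. -/
theorem span_grad_eq_top_of_maximal {β : ℂ_[p]} (hβ : IsAlgebraic ℚ β) (hβ1 : ‖β‖ ≤ 1) {n : ℕ}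
    {a : Fin n → ℚ_[p]} (ha : a ∈ polydisc p n)
    (hmax : ∀ b ∈ polydisc p n, RingHom.ker (evalHom β a) ≤ RingHom.ker (evalHom β b) →
      RingHom.ker (evalHom β b) ≤ RingHom.ker (evalHom β a)) :
    Submodule.span ℚ_[p]
      ((fun q => grad (F β q) a) '' {q : MvPolynomial (Indet n (deg β)) ℤ | F β q a = 0}) = ⊤ := by
  by_contra hspan
  have htower := isScalarTower_rat p
  have hint : IsIntegral ℚ_[p] β := hβ.isIntegral.tower_top
  obtain ⟨θ, κ, hθ, hκ1, hκ2⟩ := exists_structureConstants hβ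
  have hκ : IsStructureConstants β θ κ := ⟨hκ1, hκ2⟩
  have hspan' : Submodule.span ℚ_[p] ((fun f => grad f a) ''
      {f | f ∈ (functionAlgebra β n θ).toSubring ∧ f a = 0}) ≠ ⊤ := by
    intro h
    apply hspan
    rw [eq_top_iff, ← h, Submodule.span_le]
    rintro _ ⟨f, ⟨hf, hfa⟩, rfl⟩
    exact grad_mem_span hint hβ1 hκ hθ hf ha hfa
  obtain ⟨k, γ, hγ0, hγc, hγk, hγ⟩ := exists_curve_of_span_grad_ne_top isOpen_polydisc
    (functionAlgebra β n θ).toSubring (fun f hf x hx => analyticAt_of_mem hint hβ1 hκ hf hx)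
    (fun f hf l => exists_partialDeriv hint hβ1 hκ hf l)
    (fun k => indetValue_mem (θ := θ) (.X k)) ha hspan'
  -- Each relation vanishes on the curve only near `t = 0`; finitely many generators give one common
  -- neighbourhood.
  obtain ⟨S, hS⟩ := (inferInstance : IsNoetherianRing (MvPolynomial (Indet n (deg β)) ℤ)).noetherian
    (RingHom.ker (evalHom β a))
  have hSev : ∀ᶠ t in 𝓝 0, ∀ q ∈ S, F β q (γ t) = 0 := by
    rw [Filter.eventually_all_finset]
    intro q hq
    refine hγ _ (F_mem q) ?_
    have : q ∈ RingHom.ker (evalHom β a) := hS ▸ Submodule.subset_span hq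
    exact this
  have hU : ∀ᶠ t in 𝓝 0, γ t ∈ polydisc p n :=
    hγc.eventually_mem (isOpen_polydisc.mem_nhds (hγ0 ▸ ha))
  have hall := hSev.and (hU.and hγk)
  obtain ⟨V, hVsub, hVo, hV0⟩ := eventually_nhds_iff.1 hall
  obtain ⟨r, hrV, hra⟩ : ∃ r : ℚ, (r : ℚ_[p]) - a k ∈ V ∧ (r : ℚ_[p]) ≠ a k := by
    have hW : IsOpen ((fun y => y - a k) ⁻¹' V \ {a k}) :=
      (hVo.preimage (by fun_prop)).sdiff isClosed_singleton
    have hne : ((fun y => y - a k) ⁻¹' V \ {a k}).Nonempty := by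
      have h1 : (fun y => y - a k) ⁻¹' V ∈ 𝓝 (a k) :=
        (hVo.preimage (by fun_prop)).mem_nhds (by simpa using hV0)
      have h2 := inter_mem_nhdsWithin {a k}ᶜ h1
      obtain ⟨y, hy1, hy2⟩ := (NormedField.nhdsNE_neBot (a k)).nonempty_of_mem h2
      exact ⟨y, hy2, hy1⟩
    obtain ⟨r, hr⟩ := (Padic.denseRange_ratCast p).exists_mem_open hW hne
    exact ⟨r, hr.1, hr.2⟩
  obtain ⟨hq, hb, hbk⟩ := hVsub _ hrV
  set b := γ ((r : ℚ_[p]) - a k) with hb_def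
  have hle : RingHom.ker (evalHom β a) ≤ RingHom.ker (evalHom β b) := by
    rw [← hS, Submodule.span_le]
    exact fun q hqS => hq q hqS
  have hge := hmax b hb hle
  have hden : (r.den : ℚ_[p]) * r = r.num := by
    exact_mod_cast congrArg (fun r : ℚ => (r : ℚ_[p])) (Rat.den_mul_eq_num r)
  -- The relation `X_k = r` with its denominator cleared: it holds at `b` and fails at `a`.
  let q : MvPolynomial (Indet n (deg β)) ℤ :=
    MvPolynomial.C (r.den : ℤ) * MvPolynomial.X (.X k) - MvPolynomial.C r.num
  have hqx : ∀ x : Fin n → ℚ_[p], evalHom β x q = r.den * (x k - r) := by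
    intro x
    rw [mul_sub, hden]
    simp [evalHom, q, indetValue]
  have hqb : q ∈ RingHom.ker (evalHom β b) := by
    rw [RingHom.mem_ker, hqx, hbk]
    ring
  have hqa := hge hqb
  rw [RingHom.mem_ker, hqx] at hqa
  rcases mul_eq_zero.1 hqa with h | h
  · exact r.den_ne_zero (by exact_mod_cast h)
  · exact hra (sub_eq_zero.1 h).symm

theorem grad_F_mul {β : ℂ_[p]} (hβ : IsAlgebraic ℚ β) (hβ1 : ‖β‖ ≤ 1) {n : ℕ}
    {a : Fin n → ℚ_[p]} (ha : a ∈ polydisc p n) (q r : MvPolynomial (Indet n (deg β)) ℤ) :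
    grad (F β (q * r)) a = F β q a • grad (F β r) a + F β r a • grad (F β q) a := by
  have htower := isScalarTower_rat p
  obtain ⟨θ, κ, hθ, hκ⟩ := exists_structureConstants hβ
  have hd : ∀ q : MvPolynomial (Indet n (deg β)) ℤ, DifferentiableAt ℚ_[p] (F β q) a := fun q =>
    (analyticAt_of_mem (θ := θ) hβ.isIntegral.tower_top hβ1 hκ (F_mem q) ha).differentiableAt
  rw [← grad_mul (hd q) (hd r)]
  congr 1
  ext x
  simp [F]

theorem grad_F_sum {β : ℂ_[p]} (hβ : IsAlgebraic ℚ β) (hβ1 : ‖β‖ ≤ 1) {n : ℕ}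
    {a : Fin n → ℚ_[p]} (ha : a ∈ polydisc p n) {ι : Type*} (u : Finset ι)
    (q : ι → MvPolynomial (Indet n (deg β)) ℤ) :
    grad (F β (∑ i ∈ u, q i)) a = ∑ i ∈ u, grad (F β (q i)) a := by
  have htower := isScalarTower_rat p
  obtain ⟨θ, κ, hθ, hκ⟩ := exists_structureConstants hβ
  have hd : ∀ q : MvPolynomial (Indet n (deg β)) ℤ, DifferentiableAt ℚ_[p] (F β q) a := fun q =>
    (analyticAt_of_mem (θ := θ) hβ.isIntegral.tower_top hβ1 hκ (F_mem q) ha).differentiableAt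
  rw [← grad_sum _ fun i _ => hd _]
  congr 1
  ext x
  simp [F]

/-- Local generators of the relations at `a` have the same span of gradients as all relations. -/
theorem span_grad_local_generators {β : ℂ_[p]} (hβ : IsAlgebraic ℚ β) (hβ1 : ‖β‖ ≤ 1) {n : ℕ}
    {a : Fin n → ℚ_[p]} (ha : a ∈ polydisc p n) {τ : Type*} [Fintype τ]
    (r : τ → MvPolynomial (Indet n (deg β)) ℤ)
    (hr : IsLocalKer (evalHom β a) (Ideal.span (Set.range r)))
    (hspan : Submodule.span ℚ_[p] ((fun q => grad (F β q) a) ''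
      {q : MvPolynomial (Indet n (deg β)) ℤ | F β q a = 0}) = ⊤) :
    Submodule.span ℚ_[p] (Set.range fun i => grad (F β (r i)) a) = ⊤ := by
  rw [eq_top_iff, ← hspan, Submodule.span_le]
  rintro _ ⟨q, hq, rfl⟩
  obtain ⟨g, hg, hgq⟩ := hr.2 q hq
  obtain ⟨c, hc⟩ := Ideal.mem_span_range_iff_exists_fun.1 hgq
  have hr0 : ∀ i, F β (r i) a = 0 := fun i => hr.1 _ (Ideal.subset_span ⟨i, rfl⟩)
  -- The product rule applied to `g * q = ∑ c i * r i`, at a point where `q` and all `r i` vanish.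
  have h1 : F β g a • grad (F β q) a = ∑ i, F β (c i) a • grad (F β (r i)) a := by
    have h2 := congrArg (fun q => grad (F β q) a) hc
    simp only [grad_F_sum hβ hβ1 ha, grad_F_mul hβ hβ1 ha, hr0, zero_smul, add_zero] at h2
    rw [h2, show F β q a = 0 from hq, zero_smul, add_zero]
  rw [SetLike.mem_coe, ← Submodule.smul_mem_iff _ hg]
  change F β g a • grad (F β q) a ∈ _
  rw [h1]
  exact Submodule.sum_mem _ fun i _ => Submodule.smul_mem _ _ (Submodule.subset_span ⟨i, rfl⟩)

/-- Under Schanuel's conjecture, the relations at a linearly independent point are locally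
generated by few elements. -/
theorem exists_few_local_generators (hS : SchanuelConjecture p) {β : ℂ_[p]} (hβ : IsAlgebraic ℚ β)
    (hβ1 : ‖β‖ ≤ 1) {n : ℕ} (hn : 1 ≤ n) {a : Fin n → ℚ_[p]} (ha : a ∈ polydisc p n)
    (hli : LinearIndependent ℚ a) {T : ℕ}
    (hT : n + n + deg β * ((deg β - 1) * n) ≤ T + n * deg β) :
    ∃ r : Fin T → MvPolynomial (Indet n (deg β)) ℤ,
      IsLocalKer (evalHom β a) (Ideal.span (Set.range r)) := by
  classical
  let j := algebraMap ℚ_[p] ℂ_[p]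
  obtain ⟨s, r, halg, hr⟩ := exists_subfamily_local_generators
    fun i : Indet n (deg β) => j (indetValue β a i)
  have hcard := le_encard_of_schanuel hS hβ hβ1 hn a ha hli _ halg
  have hs : n * deg β ≤ s.ncard := by
    have h1 := hcard.trans (Set.encard_image_le _ _)
    rw [← s.toFinite.cast_ncard_eq] at h1
    exact_mod_cast h1
  have hr' : IsLocalKer (evalHom β a) (Ideal.span (Set.range r)) := by
    refine hr.of_comp_injective (j := j) j.injective fun x => ?_
    have : MvPolynomial.eval₂Hom (Int.castRingHom ℂ_[p])
        (fun i : Indet n (deg β) => j (indetValue β a i)) = j.comp (evalHom β a) :=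
      MvPolynomial.ringHom_ext (fun m => by simp [evalHom]) (fun i => by simp [evalHom])
    rw [this]
    rfl
  have hcompl : Nat.card (sᶜ : Set (Indet n (deg β))) ≤ Nat.card (Fin T) := by
    have h1 := Set.ncard_add_ncard_compl s
    rw [Indet.card] at h1
    rw [Nat.card_fin, Nat.card_coe_set_eq]
    omega
  obtain ⟨e, he⟩ : ∃ e : (sᶜ : Set (Indet n (deg β))) → Fin T, Function.Injective e := by
    have : Fintype (sᶜ : Set (Indet n (deg β))) := Fintype.ofFinite _
    rw [Nat.card_eq_fintype_card, Nat.card_eq_fintype_card] at hcompl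
    obtain ⟨e⟩ := Function.Embedding.nonempty_of_card_le hcompl
    exact ⟨e, e.injective⟩
  -- The complement of the basis may have fewer than `T` elements; the list is padded with zeros,
  -- which leaves the ideal unchanged.
  refine ⟨Function.extend e r 0, ?_⟩
  have hspan : Ideal.span (Set.range (Function.extend e r 0)) = Ideal.span (Set.range r) := by
    apply le_antisymm
    · rw [Ideal.span_le]
      rintro _ ⟨i, rfl⟩
      by_cases hi : ∃ x, e x = i
      · obtain ⟨x, rfl⟩ := hi
        rw [he.extend_apply]
        exact Ideal.subset_span ⟨x, rfl⟩
      · rw [Function.extend_apply' _ _ _ hi]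
        exact zero_mem _
    · rw [Ideal.span_le]
      rintro _ ⟨x, rfl⟩
      exact Ideal.subset_span ⟨e x, he.extend_apply _ _ _⟩
  rwa [hspan]

/-- A spanning family of `n`-dimensional vectors contains a basis. -/
theorem exists_embedding_linearIndependent {K : Type*} [Field K] {n T : ℕ}
    (v : Fin T → Fin n → K) (hv : Submodule.span K (Set.range v) = ⊤) :
    ∃ s : Fin n ↪ Fin T, LinearIndependent K fun i => v (s i) := by
  obtain ⟨κ, e, he, hspan, hli⟩ := exists_linearIndependent' K v
  let B : Module.Basis κ K (Fin n → K) := Module.Basis.mk hli (by rw [hspan, hv])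
  have : Fintype κ := FiniteDimensional.fintypeBasisIndex B
  have hcard : Fintype.card κ = n := by
    rw [← Module.finrank_eq_card_basis B]
    simp
  let σ : Fin n ≃ κ := (Fintype.equivFinOfCardEq hcard).symm
  exact ⟨⟨e ∘ σ, he.comp σ.injective⟩, hli.comp σ σ.injective⟩

end PadicExp

end

/-! ### The main theorem. -/

theorem mainTheorem7 (p : ℕ) [Fact p.Prime] (hSchanuel : PadicExp.SchanuelConjecture p)
    (β : ℂ_[p]) (hβ_alg : IsAlgebraic ℚ β) (hβ_norm : ‖β‖ ≤ 1)
    (n : ℕ) (hn : 1 ≤ n)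
    (L T : ℕ) (hL : (L : ℤ) = (PadicExp.deg β : ℤ) ^ 2 - PadicExp.deg β)
    (hT : (T : ℤ) = ((L : ℤ) - PadicExp.deg β + 2) * n)
    (P : MvPolynomial (PadicExp.Indet n (PadicExp.deg β)) ℤ)
    (hzero : ∃ a : Fin n → ℤ_[p], PadicExp.F β P (PadicExp.incl a) = 0)
    (hindep : ∀ a : Fin n → ℤ_[p], PadicExp.F β P (PadicExp.incl a) = 0 →
      LinearIndependent ℚ (PadicExp.incl a)) :
    ∃ (a : Fin n → ℤ_[p]) (R : MvPolynomial (PadicExp.Indet n (PadicExp.deg β)) ℤ)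
      (R' S : Fin T → MvPolynomial (PadicExp.Indet n (PadicExp.deg β)) ℤ),
      PadicExp.F β P (PadicExp.incl a) = 0 ∧
      (∃ s : Fin n ↪ Fin T,
        PadicExp.IsNonsingularZero (fun k => PadicExp.F β (R' (s k))) (PadicExp.incl a)) ∧
      PadicExp.F β R (PadicExp.incl a) ≠ 0 ∧
      R * P = ∑ i, R' i * S i := by
  open PadicExp in
  let 𝔮 : (Fin n → ℤ_[p]) → Ideal (MvPolynomial (Indet n (deg β)) ℤ) :=
    fun a => RingHom.ker (evalHom β (incl a))
  obtain ⟨_, ⟨a, haP, rfl⟩, hmax⟩ := set_has_maximal_iff_noetherian.2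
    (inferInstance : IsNoetherianRing (MvPolynomial (Indet n (deg β)) ℤ))
    (𝔮 '' {a | F β P (incl a) = 0}) (Set.Nonempty.image _ hzero)
  have ha := incl_mem a
  have hspan := span_grad_eq_top_of_maximal hβ_alg hβ_norm ha (by
    intro b hb hle
    obtain ⟨b, rfl⟩ := exists_incl_eq hb
    -- `P` is itself a relation at `a`, so any point with a larger ideal of relations is again a
    -- zero of `F_P` and competes in the maximality.
    have hbP : F β P (incl b) = 0 := hle haP
    by_contra hnot
    exact hmax (𝔮 b) ⟨b, hbP, rfl⟩ (lt_of_le_not_ge hle hnot))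
  have hd : 0 < deg β := by
    have := isScalarTower_rat p
    have hint : IsIntegral ℚ_[p] β := hβ_alg.isIntegral.tower_top
    rw [deg_eq hint]
    exact minpoly.natDegree_pos hint
  obtain ⟨r, hr⟩ := exists_few_local_generators hSchanuel hβ_alg hβ_norm hn ha (hindep a haP)
    (T := T) (by
      -- With `d = deg β`, both sides equal `(d² - d + 2) n`.
      zify [hd]
      rw [hT, hL]
      linarith)
  obtain ⟨s, hs⟩ := exists_embedding_linearIndependent _
    (span_grad_local_generators hβ_alg hβ_norm ha r hr hspan)
  obtain ⟨R, hR, hRP⟩ := hr.2 P haP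
  obtain ⟨S, hS⟩ := Ideal.mem_span_range_iff_exists_fun.1 hRP
  refine ⟨a, R, r, S, haP, ⟨s, fun i => hr.1 _ (Ideal.subset_span ⟨_, rfl⟩), ?_⟩, hR, ?_⟩
  · exact ((Matrix.isUnit_iff_isUnit_det _).1
      (Matrix.linearIndependent_rows_iff_isUnit.1 hs)).ne_zero
  · rw [← hS]
    exact Finset.sum_congr rfl fun i _ => mul_comm _ _
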